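/- Let $A=[a_{ij}]$ be a complex $n\times n$ matrix that is non-derogatory (in its Jordan form exactly one block belongs to each eigenvalue), let $\lambda_1,\dots,\lambda_k$ be its distinct eigenvalues, let $p\ge 2$ be an integer, $g\in\mathbb{C}[x]$ a polynomial with $g(0)\neq 0$, and put $h(x)=x^pg(x)$; let $c$ be the coefficient of $x^2$ in $h$. Consider the nilpotent complex matrices $X$ with $$XA-AX=X^pg(X).\qquad(*)$$ Let $J_m$ denote the nilpotent upper triangular Jordan block of size $m$. (a) There are integers $\alpha_1,\dots,\alpha_k\ge 1$ and an invertible matrix $P$ with entries in $\mathbb{Q}((a_{ij})_{i,j},\lambda_1,\dots,\lambda_k)$ such that $P^{-1}AP=\bigoplus_{i=1}^k(\lambda_iI_{\alpha_i}+J_{\alpha_i})$. (b) Let $\alpha_1,\dots,\alpha_k\ge 1$ be integers and $P$ an invertible complex matrix with $P^{-1}AP=\bigoplus_{i=1}^k(\lambda_iI_{\alpha_i}+J_{\alpha_i})$. For each $i$ choose $u_i=(u_{1,i},\dots,u_{\alpha_i-1,i})\in\mathbb{C}^{\alpha_i-1}$ such that, if $\alpha_i\ge 2$, one has $1-r\,c\,u_{\alpha_i-1,i}\neq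 0$ for $1\le r\le \alpha_i-2$. Let $X_i=[x_{rs}]$ be the strictly upper triangular $\alpha_i\times\alpha_i$ matrix with last column $(u_{1,i},\dots,u_{\alpha_i-1,i},0)^T$ whose other entries above the diagonal are computed one superdiagonal after the other, and from bottom to top inside each superdiagonal, by $$x_{rs}=\frac{y_{r+1,s+1}+h(Y)_{r,s+1}}{1-c\,y_{s,s+1}}\qquad(1\le r<s<\alpha_i),$$ where $Y=[y_{ab}]$ is the strictly upper triangular matrix that holds the entries on the superdiagonals preceding that of $(r,s)$ and the entries below $(r,s)$ on the same superdiagonal, and is zero elsewhere. Then $$(u_1,\dots,u_k)\longmapsto X=P\Big(\bigoplus_{i=1}^kX_i\Big)P^{-1}$$ is a bijection from the set of these families $(u_1,\dots,u_k)$ onto the set of all nilpotent solutions of $(*)$. The number of parameters is $\sum_{i=1}^k(\alpha_i-1)=n-k$. (c) If, in (b), the entries of $P$ lie in $\mathbb{Q}((a_{ij})_{i,j},\lambda_1,\dots,\lambda_k)$, then the entries of $X$ lie in the field generated over $\mathbb{Q}$ by the $a_{ij}$, the $\lambda_i$, the coefficients of $g$ and the parameters $u_{r,i}$ (the coefficients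 of $g$ may of course be omitted if they are rational). -/

import Mathlib

open Polynomial

noncomputable section

/-- The nilpotent Jordan block of size `m` (ones on the superdiagonal). -/
def nilJordanBlock (m : ℕ) : Matrix (Fin m) (Fin m) ℂ :=
  Matrix.of fun i j => if (i : ℕ) + 1 = (j : ℕ) then 1 else 0

/-- `P`, with inverse `Q`, brings `A` to the Jordan form whose blocks have the (positive) sizes
`s i` and the eigenvalues `μ i`. -/
structure IsJordanReduction {n k : ℕ} (A : Matrix (Fin n) (Fin n) ℂ) (s : Fin k → ℕ)
    (μ : Fin k → ℂ) (P : Matrix (Fin n) (Σ i, Fin (s i)) ℂ)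
    (Q : Matrix (Σ i, Fin (s i)) (Fin n) ℂ) : Prop where
  size_pos : ∀ i, 0 < s i
  mul_inv : P * Q = 1
  inv_mul : Q * P = 1
  conj_eq : Q * A * P =
    Matrix.blockDiagonal' fun i => μ i • (1 : Matrix (Fin (s i)) (Fin (s i)) ℂ)
      + nilJordanBlock (s i)

/-- A complex square matrix is non-derogatory if, in its Jordan form, exactly one block belongs to
each eigenvalue. -/
def NonDerogatory {n : ℕ} (A : Matrix (Fin n) (Fin n) ℂ) : Prop :=
  ∃ (k : ℕ) (s : Fin k → ℕ) (μ : Fin k → ℂ) (P : Matrix (Fin n) (Σ i, Fin (s i)) ℂ)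
    (Q : Matrix (Σ i, Fin (s i)) (Fin n) ℂ),
    IsJordanReduction A s μ P Q ∧
      ∀ z ∈ spectrum ℂ A, (Finset.univ.filter fun i => μ i = z).card = 1

/-- The entries `x i j` of the strictly upper triangular `m × m` matrix with last column
`(u, 0)` computed from `X J - J X = h(X)` (`J` the nilpotent Jordan block), superdiagonal after
superdiagonal and, inside each of them, from bottom to top. `Y` holds the entries that come before
`(i, j)` in this order, the others being replaced by `0`; for `j` not the last index, `x i j` is
the solution of the equation of degree one
`x i j * (1 - c * Y j (j + 1)) = Y (i + 1) (j + 1) + h(Y) i (j + 1)`,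
where `c` is the coefficient of degree two of `h`. -/
def jordanEntry {m : ℕ} (h : ℂ[X]) (u : Fin (m - 1) → ℂ) (i j : Fin m) : ℂ :=
  if hij : (i : ℕ) < (j : ℕ) then
    if hj : (j : ℕ) + 1 < m then
      let Y : Matrix (Fin m) (Fin m) ℂ := Matrix.of fun a b =>
        if _hab : (b : ℕ) - (a : ℕ) < (j : ℕ) - (i : ℕ) ∨
            ((b : ℕ) - (a : ℕ) = (j : ℕ) - (i : ℕ) ∧ (i : ℕ) < (a : ℕ)) then
          jordanEntry h u a b
        else 0
      (Y ⟨(i : ℕ) + 1, by omega⟩ ⟨(j : ℕ) + 1, hj⟩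
          + (Polynomial.aeval Y h) i ⟨(j : ℕ) + 1, hj⟩)
        / (1 - h.coeff 2 * Y j ⟨(j : ℕ) + 1, hj⟩)
    else u ⟨(i : ℕ), by omega⟩
  else 0
termination_by ((j : ℕ) - (i : ℕ), m - (i : ℕ))
decreasing_by
  rcases _hab with hab | ⟨hab, hia⟩
  · exact Prod.Lex.left _ _ hab
  · rw [hab]
    exact Prod.Lex.right _ (by omega)

/-- The matrix with entries `jordanEntry h u i j`. -/
def jordanSolution {m : ℕ} (h : ℂ[X]) (u : Fin (m - 1) → ℂ) : Matrix (Fin m) (Fin m) ℂ :=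
  Matrix.of fun i j => jordanEntry h u i j

/-- The condition `1 - i c u ≠ 0` for `1 ≤ i ≤ m - 2` on the bottom entry `u` of the chosen last
column, where `c` is the coefficient of degree two of `h`. -/
def AdmissibleColumn {m : ℕ} (h : ℂ[X]) (u : Fin (m - 1) → ℂ) : Prop :=
  ∀ (hm : 2 ≤ m) (i : ℕ), 1 ≤ i → i ≤ m - 2 →
    1 - (i : ℂ) * h.coeff 2 * u ⟨m - 2, by omega⟩ ≠ 0

/-- The matrix `P (⨁ᵢ Xᵢ) Q`, where `Xᵢ` is computed from the last column `u i`. -/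
def solutionOf {n k : ℕ} {s : Fin k → ℕ} (P : Matrix (Fin n) (Σ i, Fin (s i)) ℂ)
    (Q : Matrix (Σ i, Fin (s i)) (Fin n) ℂ) (h : ℂ[X]) (u : ∀ i, Fin (s i - 1) → ℂ) :
    Matrix (Fin n) (Fin n) ℂ :=
  P * Matrix.blockDiagonal' (fun i => jordanSolution h (u i)) * Q

/-- The set of the entries of a matrix. -/
def entrySet {m n : Type*} (M : Matrix m n ℂ) : Set ℂ := {z | ∃ i j, M i j = z}

end

/-!
Write `h = X ^ p * g`, a polynomial of order at least two, `c` for its coefficient of degree two,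
`J` for a nilpotent Jordan block and `D` for the Jordan form of `A`. Conjugation turns the equation
into `M D - D M = h(M)`, and three facts describe its nilpotent solutions.

* `M` is block diagonal (`mem_blockDiagonalSubmodule_of_equation`). Commutation with `D` acts as a
  derivation on powers of `M`, so `[M ^ r, D] = r M ^ (r - 1) h(M)` is a combination of higher
  powers of `M`. As the eigenvalues are distinct, a matrix whose commutator with `D` is block
  diagonal is itself block diagonal (the Sylvester equation between different blocks has only the
  trivial solution), and downward induction on `r` reaches `M`.
* Each block solves `M J - J M = h(M)` and is strictly upper triangular
  (`strictUpper_of_isNilpotent`). Inductively `M` stabilises the flag of `J`: the preimage under `M`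
  of a member `V` of the flag is stable under `J` and strictly contains `V`, hence contains the next
  member.
* For strictly upper triangular `M` the equation says `x_{i,j} = x_{i+1,j+1} + h(M)_{i,j+1}`
  (`StrictUpper.equation_iff`), and the right-hand side is affine in `x_{i,j}`, with slope
  `c x_{j,j+1}` and the constant term given by the preceding entries
  (`StrictUpper.aeval_apply_succ`). Solving for `x_{i,j}` is the recursion of `jordanEntry`, so the
  last column determines the solution. On the first superdiagonal the recursion is
  `x (1 - c x') = x'`, that is `1 / x = 1 / x' - c`, so the entry in distance `t` from the bottom
  is `w / (1 - t c w)`, with `w` the bottom entry. Therefore the denominators of the recursion do not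
  vanish exactly if the last column is admissible
  (`AdmissibleColumn.denominator_ne_zero`, `StrictUpper.admissibleColumn`).

The recursion uses field operations only, and the inverse of `P` has its entries in the field
generated by those of `P`, which settles the field of definition of the solutions. For a Jordan
basis over the field generated by the entries and the eigenvalues of `A`
(`IsJordanReduction.exists_entries_mem`), let `q` be the product of the `(X - μ j) ^ s j` with
`j ≠ i`. As `q(A) (A - μ i) ^ (s i - 1)` does not vanish, one of its columns does not, and the
corresponding column of `q(A)` generates a Jordan chain for `μ i` of full length. These chains form
a basis, since the kernel of the matrix formed by them is stable under `D` but contains no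
eigenvector of `D`.
-/

noncomputable section

/-! ### Polynomials in strictly upper triangular matrices -/

/-- Strict upper triangularity of a square matrix indexed by `Fin m`. -/
def StrictUpper {R : Type*} [Zero R] {m : ℕ} (M : Matrix (Fin m) (Fin m) R) : Prop :=
  ∀ a b : Fin m, (b : ℕ) ≤ (a : ℕ) → M a b = 0

section

variable {R : Type*} [CommRing R] {m : ℕ} {M N : Matrix (Fin m) (Fin m) R}

theorem StrictUpper.pow_apply_eq_zero (hM : StrictUpper M) (k : ℕ) :
    ∀ a b : Fin m, (b : ℕ) < (a : ℕ) + k → (M ^ k) a b = 0 := by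
  induction k with
  | zero =>
    intro a b hab
    rw [pow_zero, Matrix.one_apply_ne]
    rintro rfl
    omega
  | succ k ih =>
    intro a b hab
    rw [pow_succ, Matrix.mul_apply]
    refine Finset.sum_eq_zero fun t _ => ?_
    by_cases ht : (t : ℕ) < (a : ℕ) + k
    · rw [ih a t ht, zero_mul]
    · rw [hM t b (by omega), mul_zero]

theorem StrictUpper.isNilpotent (hM : StrictUpper M) : IsNilpotent M :=
  ⟨m, by ext a b; exact hM.pow_apply_eq_zero m a b (by omega)⟩

/-- A product of `k + 1` entries along an increasing path of length at most `d + k - 1` uses only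
entries of distance less than `d` from the diagonal. -/
theorem StrictUpper.pow_apply_congr (hM : StrictUpper M) (hN : StrictUpper N) {d : ℕ}
    (h : ∀ a b : Fin m, (b : ℕ) < (a : ℕ) + d → M a b = N a b) (k : ℕ) :
    ∀ a b : Fin m, (b : ℕ) < (a : ℕ) + d + k → (M ^ (k + 1)) a b = (N ^ (k + 1)) a b := by
  induction k with
  | zero =>
    intro a b hab
    simpa using h a b (by omega)
  | succ k ih =>
    intro a b hab
    rw [pow_succ M (k + 1), pow_succ N (k + 1), Matrix.mul_apply, Matrix.mul_apply]
    refine Finset.sum_congr rfl fun t _ => ?_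
    by_cases hat : (t : ℕ) < (a : ℕ) + (k + 1)
    · rw [hM.pow_apply_eq_zero _ a t hat, hN.pow_apply_eq_zero _ a t hat, zero_mul, zero_mul]
    by_cases htb : (b : ℕ) ≤ (t : ℕ)
    · rw [hM t b htb, hN t b htb, mul_zero, mul_zero]
    · rw [ih a t (by omega), h t b (by omega)]

/-- The matrix keeping the entries of `M` that precede the position `(i, j)`, superdiagonal after
superdiagonal and from bottom to top inside each of them, the others being replaced by `0`. -/
def precedingPart (M : Matrix (Fin m) (Fin m) R) (i j : Fin m) : Matrix (Fin m) (Fin m) R :=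
  Matrix.of fun a b =>
    if (b : ℕ) - (a : ℕ) < (j : ℕ) - (i : ℕ) ∨
        ((b : ℕ) - (a : ℕ) = (j : ℕ) - (i : ℕ) ∧ (i : ℕ) < (a : ℕ)) then M a b else 0

theorem precedingPart_apply_of_prec (M : Matrix (Fin m) (Fin m) R) {i j a b : Fin m}
    (h : (b : ℕ) - (a : ℕ) < (j : ℕ) - (i : ℕ) ∨
        ((b : ℕ) - (a : ℕ) = (j : ℕ) - (i : ℕ) ∧ (i : ℕ) < (a : ℕ))) :
    precedingPart M i j a b = M a b := by
  rw [precedingPart, Matrix.of_apply, if_pos h]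

theorem precedingPart_self (M : Matrix (Fin m) (Fin m) R) (i j : Fin m) :
    precedingPart M i j i j = 0 := by
  rw [precedingPart, Matrix.of_apply, if_neg (by omega)]

theorem StrictUpper.strictUpper_precedingPart (hM : StrictUpper M) (i j : Fin m) :
    StrictUpper (precedingPart M i j) := by
  intro a b hab
  rw [precedingPart, Matrix.of_apply, hM a b hab, ite_self]

/-- The position `(i, j + 1)` of `M ^ 2` sees, beyond the entries preceding `(i, j)`, only the
product `M i j * M j (j + 1)`. -/
theorem StrictUpper.sq_apply_succ (hM : StrictUpper M) {i j : Fin m} (hij : (i : ℕ) < (j : ℕ))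
    (hj : (j : ℕ) + 1 < m) :
    (M ^ 2) i ⟨j + 1, hj⟩ =
      (precedingPart M i j ^ 2) i ⟨j + 1, hj⟩ + M i j * M j ⟨j + 1, hj⟩ := by
  have hN := hM.strictUpper_precedingPart i j
  rw [← sub_eq_iff_eq_add', pow_two, pow_two, Matrix.mul_apply, Matrix.mul_apply,
    ← Finset.sum_sub_distrib, Finset.sum_eq_single j]
  · rw [precedingPart_self, zero_mul, sub_zero]
  · intro t _ htj
    have htj' : (t : ℕ) ≠ (j : ℕ) := fun h => htj (Fin.ext h)
    by_cases h1 : (t : ℕ) ≤ (i : ℕ)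
    · rw [hM i t h1, hN i t h1]; simp
    by_cases h2 : (j : ℕ) < (t : ℕ)
    · rw [hM t ⟨j + 1, hj⟩ h2, hN t ⟨j + 1, hj⟩ h2]; simp
    · rw [precedingPart_apply_of_prec M (Or.inl (by omega)),
        precedingPart_apply_of_prec M (a := t) (b := ⟨j + 1, hj⟩) (by simp only; omega), sub_self]
  · simp

/-- For `h` of order at least two, the position `(i, j + 1)` of `h(M)` depends on `M i j` and the
preceding entries only, and is affine in `M i j`. -/
theorem StrictUpper.aeval_apply_succ (hM : StrictUpper M) {h : R[X]} (h0 : h.coeff 0 = 0)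
    (h1 : h.coeff 1 = 0) {i j : Fin m} (hij : (i : ℕ) < (j : ℕ)) (hj : (j : ℕ) + 1 < m) :
    (aeval M h) i ⟨j + 1, hj⟩ =
      (aeval (precedingPart M i j) h) i ⟨j + 1, hj⟩ +
        h.coeff 2 * (M i j * M j ⟨j + 1, hj⟩) := by
  have hN := hM.strictUpper_precedingPart i j
  rw [← sub_eq_iff_eq_add', aeval_eq_sum_range, aeval_eq_sum_range, Matrix.sum_apply,
    Matrix.sum_apply, ← Finset.sum_sub_distrib, Finset.sum_eq_single 2]
  · rw [Matrix.smul_apply, Matrix.smul_apply, hM.sq_apply_succ hij hj, smul_eq_mul, smul_eq_mul]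
    ring
  · intro k _ hk2
    rcases k with _ | _ | _ | k
    · simp [h0]
    · simp [h1]
    · exact absurd rfl hk2
    · rw [Matrix.smul_apply, Matrix.smul_apply,
        hM.pow_apply_congr hN (d := (j : ℕ) - (i : ℕ)) _ (k + 2) i ⟨j + 1, hj⟩
          (by simp only; omega), sub_self]
      intro a b hab
      by_cases hba : (b : ℕ) ≤ (a : ℕ)
      · rw [hM a b hba, hN a b hba]
      · rw [precedingPart_apply_of_prec M (Or.inl (by omega))]
  · intro hmem
    rw [coeff_eq_zero_of_natDegree_lt (by simpa using hmem)]
    simp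

/-- For `h` of order at least two and `M` strictly upper triangular, `h(M)` vanishes below the
second superdiagonal. -/
theorem StrictUpper.aeval_apply_eq_zero (hM : StrictUpper M) {h : R[X]} (h0 : h.coeff 0 = 0)
    (h1 : h.coeff 1 = 0) {a b : Fin m} (hab : (b : ℕ) < (a : ℕ) + 2) : (aeval M h) a b = 0 := by
  rw [aeval_eq_sum_range, Matrix.sum_apply]
  refine Finset.sum_eq_zero fun k _ => ?_
  rcases k with _ | _ | k
  · simp [h0]
  · simp [h1]
  · rw [Matrix.smul_apply, hM.pow_apply_eq_zero _ a b (by omega), smul_zero]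

theorem StrictUpper.aeval_apply_add_two (hM : StrictUpper M) {h : R[X]} (h0 : h.coeff 0 = 0)
    (h1 : h.coeff 1 = 0) {i : ℕ} (hi : i + 2 < m) :
    (aeval M h) ⟨i, by omega⟩ ⟨i + 2, hi⟩ =
      h.coeff 2 * (M ⟨i, by omega⟩ ⟨i + 1, by omega⟩ * M ⟨i + 1, by omega⟩ ⟨i + 2, hi⟩) := by
  rw [aeval_eq_sum_range, Matrix.sum_apply, Finset.sum_eq_single 2]
  · rw [Matrix.smul_apply, pow_two, Matrix.mul_apply, smul_eq_mul,
      Finset.sum_eq_single ⟨i + 1, by omega⟩]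
    · intro t _ ht
      have ht' : (t : ℕ) ≠ i + 1 := fun h => ht (Fin.ext h)
      by_cases h1 : (t : ℕ) ≤ i
      · rw [hM _ t (by simpa using h1), zero_mul]
      · rw [hM t _ (by simp only; omega), mul_zero]
    · simp
  · intro k _ hk
    rcases k with _ | _ | _ | k
    · simp [h0]
    · simp [h1]
    · exact absurd rfl hk
    · rw [Matrix.smul_apply, hM.pow_apply_eq_zero _ _ _ (by simp only; omega), smul_zero]
  · intro hmem
    rw [coeff_eq_zero_of_natDegree_lt (by simpa using hmem)]
    simp

end

/-! ### The recursion for one Jordan block -/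

theorem jordanSolution_strictUpper {m : ℕ} (h : ℂ[X]) (u : Fin (m - 1) → ℂ) :
    StrictUpper (jordanSolution h u) := by
  intro a b hab
  rw [jordanSolution, Matrix.of_apply, jordanEntry, dif_neg (by omega)]

theorem jordanSolution_apply_last {m : ℕ} (h : ℂ[X]) (u : Fin (m - 1) → ℂ) (i : Fin (m - 1)) :
    jordanSolution h u ⟨i, by omega⟩ ⟨m - 1, by have := i.2; omega⟩ = u i := by
  rw [jordanSolution, Matrix.of_apply, jordanEntry, dif_pos (by simp only; omega),
    dif_neg (by simp only; omega)]

/-- The recursion defining `jordanEntry`, stated for the whole matrix. -/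
theorem jordanSolution_apply {m : ℕ} (h : ℂ[X]) (u : Fin (m - 1) → ℂ) {i j : Fin m}
    (hij : (i : ℕ) < (j : ℕ)) (hj : (j : ℕ) + 1 < m) :
    jordanSolution h u i j =
      (jordanSolution h u ⟨i + 1, by omega⟩ ⟨j + 1, hj⟩ +
          (aeval (precedingPart (jordanSolution h u) i j) h) i ⟨j + 1, hj⟩) /
        (1 - h.coeff 2 * jordanSolution h u j ⟨j + 1, hj⟩) := by
  have hY : (Matrix.of fun a b : Fin m => if _hab : (b : ℕ) - (a : ℕ) < (j : ℕ) - (i : ℕ) ∨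
      ((b : ℕ) - (a : ℕ) = (j : ℕ) - (i : ℕ) ∧ (i : ℕ) < (a : ℕ)) then
        jordanEntry h u a b else 0) = precedingPart (jordanSolution h u) i j := by
    ext a b
    simp [precedingPart, jordanSolution]
  conv_lhs => rw [jordanSolution, Matrix.of_apply, jordanEntry, dif_pos hij, dif_pos hj]
  simp only
  rw [hY, precedingPart_apply_of_prec (a := ⟨i + 1, by omega⟩) (b := ⟨j + 1, hj⟩) _
      (by simp only; omega),
    precedingPart_apply_of_prec (a := j) (b := ⟨j + 1, hj⟩) _ (by simp only; omega)]

/-! ### The matrix equation for one Jordan block -/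

/-- The entry `(a, b + 1)` of `M J` is the entry `(a, b)` of `M`. -/
theorem mul_nilJordanBlock_apply_succ {m : ℕ} {ι : Type*} (M : Matrix ι (Fin m) ℂ)
    (a : ι) (b : ℕ) (hb : b + 1 < m) :
    (M * nilJordanBlock m) a ⟨b + 1, hb⟩ = M a ⟨b, by omega⟩ := by
  rw [Matrix.mul_apply, Finset.sum_eq_single ⟨b, by omega⟩]
  · simp [nilJordanBlock]
  · intro t _ ht
    have ht' : (t : ℕ) ≠ b := fun h => ht (Fin.ext h)
    simp [nilJordanBlock, ht']
  · simp

theorem mul_nilJordanBlock_apply_zero {m : ℕ} {ι : Type*} (M : Matrix ι (Fin m) ℂ)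
    (a : ι) (hm : 0 < m) : (M * nilJordanBlock m) a ⟨0, hm⟩ = 0 := by
  rw [Matrix.mul_apply]
  exact Finset.sum_eq_zero fun t _ => by simp [nilJordanBlock]

theorem nilJordanBlock_mul_apply {m : ℕ} {ι : Type*} (M : Matrix (Fin m) ι ℂ)
    (a : ℕ) (b : ι) (ha : a + 1 < m) :
    (nilJordanBlock m * M) ⟨a, by omega⟩ b = M ⟨a + 1, ha⟩ b := by
  rw [Matrix.mul_apply, Finset.sum_eq_single ⟨a + 1, by omega⟩]
  · simp [nilJordanBlock]
  · intro t _ ht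
    have ht' : (t : ℕ) ≠ a + 1 := fun h => ht (Fin.ext h)
    simp [nilJordanBlock, Ne.symm ht']
  · simp

theorem nilJordanBlock_mul_apply_last {m : ℕ} {ι : Type*} (M : Matrix (Fin m) ι ℂ)
    (a : Fin m) (b : ι) (ha : (a : ℕ) + 1 = m) : (nilJordanBlock m * M) a b = 0 := by
  rw [Matrix.mul_apply]
  refine Finset.sum_eq_zero fun t _ => ?_
  have := t.2
  simp only [nilJordanBlock, Matrix.of_apply]
  rw [if_neg (by omega), zero_mul]

/-- For strictly upper triangular `M`, the matrix equation `M J - J M = h(M)` amounts to the scalar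
equations at the positions `(i, j + 1)` with `i < j`. -/
theorem StrictUpper.equation_iff {m : ℕ} {M : Matrix (Fin m) (Fin m) ℂ} (hM : StrictUpper M)
    {h : ℂ[X]} (h0 : h.coeff 0 = 0) (h1 : h.coeff 1 = 0) :
    M * nilJordanBlock m - nilJordanBlock m * M = aeval M h ↔
      ∀ (i j : Fin m) (hij : (i : ℕ) < (j : ℕ)) (hj : (j : ℕ) + 1 < m),
        M i j = M ⟨i + 1, by omega⟩ ⟨j + 1, hj⟩ + (aeval M h) i ⟨j + 1, hj⟩ := by
  constructor
  · intro H i j hij hj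
    rw [← H, Matrix.sub_apply, mul_nilJordanBlock_apply_succ,
      nilJordanBlock_mul_apply M i _ (by omega)]
    ring
  · intro H
    ext a b
    rw [Matrix.sub_apply]
    obtain ⟨b, hb⟩ := b
    by_cases hab : b < (a : ℕ) + 2
    · rw [hM.aeval_apply_eq_zero h0 h1 hab]
      have e1 : (M * nilJordanBlock m) a ⟨b, hb⟩ = 0 := by
        rcases b with _ | b
        · rw [mul_nilJordanBlock_apply_zero]
        · rw [mul_nilJordanBlock_apply_succ, hM _ _ (by simp only; omega)]
      have e2 : (nilJordanBlock m * M) a ⟨b, hb⟩ = 0 := by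
        by_cases ha : (a : ℕ) + 1 < m
        · rw [nilJordanBlock_mul_apply M a _ ha, hM _ _ (by simp only; omega)]
        · rw [nilJordanBlock_mul_apply_last M a _ (by omega)]
      rw [e1, e2, sub_zero]
    · obtain ⟨b, rfl⟩ : ∃ c, b = c + 1 := ⟨b - 1, by omega⟩
      rw [mul_nilJordanBlock_apply_succ, nilJordanBlock_mul_apply M a _ (by omega),
        H a ⟨b, by omega⟩ (by simp only; omega) hb]
      ring

/-- On the first superdiagonal the recursion reads `x (1 - c x') = x'`, where `x'` is the entry
below `x`; hence the entry in distance `t` from the bottom is `w / (1 - t c w)`. -/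
theorem one_sub_mul_eq_of_recursion {R : Type*} [CommRing R] {c w : R} {x : ℕ → R} {N : ℕ}
    (hx0 : x 0 = w) (hx : ∀ t, t < N → x (t + 1) * (1 - c * x t) = x t) :
    ∀ t, t ≤ N → (1 - t * c * w) * x t = w ∧
      (1 - t * c * w) * (1 - c * x t) = 1 - (t + 1 : ℕ) * c * w := by
  have key : ∀ t, t ≤ N → (1 - t * c * w) * x t = w := by
    intro t
    induction t with
    | zero => intro _; simp [hx0]
    | succ t ih =>
      intro ht
      have := ih (by omega)
      have h2 := hx t (by omega)
      push_cast
      linear_combination (1 + x (t + 1) * c) * this + (1 - t * c * w) * h2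
  intro t ht
  refine ⟨key t ht, ?_⟩
  push_cast
  linear_combination (-c) * key t ht

/-- The first superdiagonal read from the bottom, continued by `0`. -/
def bottomUpSuperdiagonal {m : ℕ} (M : Matrix (Fin m) (Fin m) ℂ) (t : ℕ) : ℂ :=
  if ht : t + 2 ≤ m then M ⟨m - 2 - t, by omega⟩ ⟨m - 1 - t, by omega⟩ else 0

theorem bottomUpSuperdiagonal_eq {m : ℕ} (M : Matrix (Fin m) (Fin m) ℂ) {j t : ℕ}
    (hj : j + t + 2 = m) :
    bottomUpSuperdiagonal M t = M ⟨j, by omega⟩ ⟨j + 1, by omega⟩ := by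
  rw [bottomUpSuperdiagonal, dif_pos (by omega)]
  congr 2 <;> omega

/-- The denominators of the recursion do not vanish for an admissible last column. -/
theorem AdmissibleColumn.denominator_ne_zero {m : ℕ} {h : ℂ[X]} (h0 : h.coeff 0 = 0)
    (h1 : h.coeff 1 = 0) {u : Fin (m - 1) → ℂ} (hu : AdmissibleColumn h u) {j : Fin m}
    (hj0 : 0 < (j : ℕ)) (hj : (j : ℕ) + 1 < m) :
    1 - h.coeff 2 * jordanSolution h u j ⟨j + 1, hj⟩ ≠ 0 := by
  set c := h.coeff 2
  set w := u ⟨m - 2, by omega⟩ with hw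
  set x := bottomUpSuperdiagonal (jordanSolution h u) with hx
  have hx0 : x 0 = w := by
    rw [hx, bottomUpSuperdiagonal_eq _ (j := m - 2) (by omega), hw,
      ← jordanSolution_apply_last h u ⟨m - 2, by omega⟩]
    congr 2
    omega
  have step : ∀ t, t + 3 ≤ m → 1 - c * x t ≠ 0 → x (t + 1) * (1 - c * x t) = x t := by
    intro t ht hne
    have e1 : x (t + 1) = _ :=
      bottomUpSuperdiagonal_eq (jordanSolution h u) (j := m - 3 - t) (by omega)
    have e2 : x t = _ :=
      bottomUpSuperdiagonal_eq (jordanSolution h u) (j := m - 3 - t + 1) (by omega)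
    have hS := jordanSolution_strictUpper h u
    have e3 := jordanSolution_apply h u (i := ⟨m - 3 - t, by omega⟩)
      (j := ⟨m - 3 - t + 1, by omega⟩) (by simp only; omega) (by simp only; omega)
    rw [(hS.strictUpper_precedingPart _ _).aeval_apply_add_two h0 h1 (by omega), precedingPart_self, zero_mul,
      mul_zero, add_zero] at e3
    rw [e2] at hne
    rw [e1, e2, e3, div_mul_cancel₀ _ hne]
  have all : ∀ t, t + 3 ≤ m → ∀ s, s ≤ t → 1 - c * x s ≠ 0 := by
    intro t
    induction t with
    | zero =>
      intro ht s hs hzero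
      obtain rfl : s = 0 := by omega
      rw [hx0] at hzero
      exact hu (by omega) 1 le_rfl (by omega) (by simpa using hzero)
    | succ t ih =>
      intro ht s hs hzero
      have ih' := ih (by omega)
      by_cases hst : s ≤ t
      · exact ih' s hst hzero
      have := (one_sub_mul_eq_of_recursion (N := t + 1) hx0
        (fun r hr => step r (by omega) (ih' r (by omega))) s (by omega)).2
      rw [hzero, mul_zero] at this
      exact hu (by omega) (s + 1) (by omega) (by omega) this.symm
  have := all (m - 2 - j) (by omega) _ le_rfl
  rwa [hx, bottomUpSuperdiagonal_eq _ (j := j) (by omega)] at this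

/-- The recursion solves the matrix equation. -/
theorem jordanSolution_equation {m : ℕ} {h : ℂ[X]} (h0 : h.coeff 0 = 0) (h1 : h.coeff 1 = 0)
    {u : Fin (m - 1) → ℂ} (hu : AdmissibleColumn h u) :
    jordanSolution h u * nilJordanBlock m - nilJordanBlock m * jordanSolution h u =
      aeval (jordanSolution h u) h := by
  have hS := jordanSolution_strictUpper h u
  rw [hS.equation_iff h0 h1]
  intro i j hij hj
  have hne := hu.denominator_ne_zero h0 h1 (j := j) (by omega) hj
  have e := jordanSolution_apply h u hij hj
  rw [eq_div_iff hne] at e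
  rw [hS.aeval_apply_succ h0 h1 hij hj]
  linear_combination e

section

variable {m : ℕ} {M : Matrix (Fin m) (Fin m) ℂ} {h : ℂ[X]}

/-- For a solution, `1 - c x' = 0` is impossible, as `x (1 - c x') = x'` would give `x' = 0`. -/
theorem StrictUpper.denominator_ne_zero (hM : StrictUpper M) (h0 : h.coeff 0 = 0)
    (h1 : h.coeff 1 = 0) (heq : M * nilJordanBlock m - nilJordanBlock m * M = aeval M h)
    {j : Fin m} (hj0 : 0 < (j : ℕ)) (hj : (j : ℕ) + 1 < m) :
    (M ⟨j - 1, by omega⟩ j * (1 - h.coeff 2 * M j ⟨j + 1, hj⟩) = M j ⟨j + 1, hj⟩) ∧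
    1 - h.coeff 2 * M j ⟨j + 1, hj⟩ ≠ 0 := by
  obtain ⟨j, hjm⟩ := j
  obtain ⟨i, rfl⟩ : ∃ i, j = i + 1 := ⟨j - 1, by simp only at hj0; omega⟩
  have e := (hM.equation_iff h0 h1).1 heq ⟨i, by omega⟩ ⟨i + 1, by omega⟩ (by simp) hj
  rw [hM.aeval_apply_add_two h0 h1 hj] at e
  have rel : M ⟨i, by omega⟩ ⟨i + 1, by omega⟩ *
      (1 - h.coeff 2 * M ⟨i + 1, by omega⟩ ⟨i + 1 + 1, hj⟩) =
        M ⟨i + 1, by omega⟩ ⟨i + 1 + 1, hj⟩ := by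
    linear_combination e
  refine ⟨rel, fun hz => ?_⟩
  simp only at hz
  rw [hz, mul_zero] at rel
  rw [← rel] at hz
  simp at hz

theorem StrictUpper.admissibleColumn (hM : StrictUpper M) (h0 : h.coeff 0 = 0)
    (h1 : h.coeff 1 = 0) (heq : M * nilJordanBlock m - nilJordanBlock m * M = aeval M h) :
    AdmissibleColumn h fun i : Fin (m - 1) =>
      M ⟨i, by omega⟩ ⟨m - 1, by have := i.2; omega⟩ := by
  intro hm i hi1 hi
  set w := M ⟨m - 2, by omega⟩ ⟨m - 1, by omega⟩ with hw
  set c := h.coeff 2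
  set x := bottomUpSuperdiagonal M with hx
  have hx0 : x 0 = w := by
    rw [hx, bottomUpSuperdiagonal_eq _ (j := m - 2) (by omega)]
    congr 2
    omega
  have step : ∀ t, t + 3 ≤ m → x (t + 1) * (1 - c * x t) = x t ∧ 1 - c * x t ≠ 0 := by
    intro t ht
    have e1 : x (t + 1) = _ := bottomUpSuperdiagonal_eq M (j := m - 3 - t) (by omega)
    have e2 : x t = _ := bottomUpSuperdiagonal_eq M (j := m - 3 - t + 1) (by omega)
    have := hM.denominator_ne_zero h0 h1 heq (j := ⟨m - 3 - t + 1, by omega⟩) (by simp)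
      (by simp only; omega)
    rw [e1, e2]
    exact this
  have prod : ∀ t, t + 2 ≤ m → (1 : ℂ) - t * c * w ≠ 0 := by
    intro t
    induction t with
    | zero => intro _; simp
    | succ t ih =>
      intro ht
      have := (one_sub_mul_eq_of_recursion (N := t) hx0
        (fun r hr => (step r (by omega)).1) t le_rfl).2
      rw [← this]
      exact mul_ne_zero (ih (by omega)) (step t (by omega)).2
  exact prod i (by omega)

/-- A strictly upper triangular solution is determined by its last column. -/
theorem StrictUpper.eq_jordanSolution (hM : StrictUpper M) (h0 : h.coeff 0 = 0)
    (h1 : h.coeff 1 = 0) (heq : M * nilJordanBlock m - nilJordanBlock m * M = aeval M h) :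
    M = jordanSolution h fun i : Fin (m - 1) =>
      M ⟨i, by omega⟩ ⟨m - 1, by have := i.2; omega⟩ := by
  set u : Fin (m - 1) → ℂ := fun i =>
    M ⟨i, by omega⟩ ⟨m - 1, by have := i.2; omega⟩ with hu
  have hS := jordanSolution_strictUpper h u
  -- Induction along the order in which the entries are computed.
  have key : ∀ d r : ℕ, ∀ i j : Fin m, (j : ℕ) - (i : ℕ) = d → m - (i : ℕ) = r →
      M i j = jordanSolution h u i j := by
    intro d
    induction d using Nat.strong_induction_on with
    | _ d ihd =>
    intro r
    induction r using Nat.strong_induction_on with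
    | _ r ihr =>
    intro i j hd hr
    by_cases hij : (i : ℕ) < (j : ℕ)
    swap
    · rw [hM i j (by omega), hS i j (by omega)]
    have prec : ∀ a b : Fin m, ((b : ℕ) - (a : ℕ) < (j : ℕ) - (i : ℕ) ∨
        ((b : ℕ) - (a : ℕ) = (j : ℕ) - (i : ℕ) ∧ (i : ℕ) < (a : ℕ))) →
        M a b = jordanSolution h u a b := by
      rintro a b (hab | ⟨hab, hia⟩)
      · exact ihd _ (by omega) _ a b rfl rfl
      · exact ihr (m - a) (by omega) a b (by omega) rfl
    by_cases hj : (j : ℕ) + 1 < m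
    · have hY : precedingPart M i j = precedingPart (jordanSolution h u) i j := by
        ext a b
        simp only [precedingPart, Matrix.of_apply]
        split_ifs with hab
        · exact prec a b hab
        · rfl
      have hne := (hM.denominator_ne_zero h0 h1 heq (j := j) (by omega) hj).2
      have e := (hM.equation_iff h0 h1).1 heq i j hij hj
      rw [hM.aeval_apply_succ h0 h1 hij hj, hY] at e
      rw [jordanSolution_apply h u hij hj, ← prec j ⟨j + 1, hj⟩ (by simp only; omega),
        ← prec ⟨i + 1, by omega⟩ ⟨j + 1, hj⟩ (by simp only; omega), eq_div_iff hne]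
      linear_combination e
    · have hj' : j = ⟨m - 1, by omega⟩ := Fin.ext (by simp only; omega)
      rw [hj']
      exact (jordanSolution_apply_last h u ⟨i, by omega⟩).symm
  ext i j
  exact key _ _ i j rfl rfl

end

/-! ### Commutators and stable subspaces -/

/-- If `[M, D]` commutes with `M`, commutation with `D` acts on powers of `M` like a derivation. -/
theorem pow_succ_mul_sub_mul_pow_succ {R : Type*} [Ring R] {M D H : R}
    (hD : M * D - D * M = H) (hH : Commute M H) (k : ℕ) :
    M ^ (k + 1) * D - D * M ^ (k + 1) = (k + 1) • (M ^ k * H) := by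
  induction k with
  | zero => simpa using hD
  | succ k ih =>
    have e : M ^ (k + 2) * D - D * M ^ (k + 2) =
        (M ^ (k + 1) * D - D * M ^ (k + 1)) * M + M ^ (k + 1) * (M * D - D * M) := by
      rw [pow_succ M (k + 1)]
      noncomm_ring
    have e2 : M ^ k * H * M = M ^ (k + 1) * H := by
      rw [mul_assoc, ← hH.eq, ← mul_assoc, ← pow_succ]
    rw [e, ih, hD, smul_mul_assoc, e2, succ_nsmul _ (k + 1)]

theorem aeval_mulVec_mem {ι : Type*} [Fintype ι] [DecidableEq ι] {M : Matrix ι ι ℂ}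
    {V : Submodule ℂ (ι → ℂ)} (hV : ∀ v ∈ V, M.mulVec v ∈ V) (q : ℂ[X]) :
    ∀ v ∈ V, (aeval M q).mulVec v ∈ V := by
  induction q using Polynomial.induction_on with
  | C a =>
    intro v hv
    rw [aeval_C, Algebra.algebraMap_eq_smul_one, Matrix.smul_mulVec, Matrix.one_mulVec]
    exact V.smul_mem a hv
  | add p q hp hq =>
    intro v hv
    rw [map_add, Matrix.add_mulVec]
    exact V.add_mem (hp v hv) (hq v hv)
  | monomial n a ih =>
    intro v hv
    rw [pow_succ, ← mul_assoc, map_mul, aeval_X, ← Matrix.mulVec_mulVec]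
    exact ih _ (hV v hv)

/-! ### Triangularity of nilpotent solutions -/

section Triangular

variable {m : ℕ}

/-- The vectors whose coordinates from the index `k` on vanish. -/
def initialSpan (m k : ℕ) : Submodule ℂ (Fin m → ℂ) where
  carrier := {v | ∀ i : Fin m, k ≤ (i : ℕ) → v i = 0}
  add_mem' := fun hv hw i hi => by rw [Pi.add_apply, hv i hi, hw i hi, add_zero]
  zero_mem' := fun _ _ => rfl
  smul_mem' := fun c v hv i hi => by rw [Pi.smul_apply, hv i hi, smul_zero]

theorem nilJordanBlock_mulVec_apply (v : Fin m → ℂ) (a : ℕ) (ha : a + 1 < m) :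
    (nilJordanBlock m).mulVec v ⟨a, by omega⟩ = v ⟨a + 1, ha⟩ := by
  rw [Matrix.mulVec, dotProduct, Finset.sum_eq_single ⟨a + 1, ha⟩]
  · simp [nilJordanBlock]
  · intro t _ ht
    have ht' : (t : ℕ) ≠ a + 1 := fun h => ht (Fin.ext h)
    simp [nilJordanBlock, Ne.symm ht']
  · simp

theorem nilJordanBlock_mulVec_apply_last (v : Fin m → ℂ) (a : Fin m) (ha : (a : ℕ) + 1 = m) :
    (nilJordanBlock m).mulVec v a = 0 := by
  rw [Matrix.mulVec, dotProduct]
  refine Finset.sum_eq_zero fun t _ => ?_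
  have := t.2
  simp only [nilJordanBlock, Matrix.of_apply]
  rw [if_neg (by omega), zero_mul]

/-- A subspace stable under the Jordan block and strictly larger than the span of the first `k`
basis vectors contains the next basis vector. -/
theorem single_mem_of_nilJordanBlock_stable {U : Submodule ℂ (Fin m → ℂ)}
    (hU : ∀ v ∈ U, (nilJordanBlock m).mulVec v ∈ U) {k : ℕ} (hk : k < m)
    (hkU : initialSpan m k ≤ U) {v : Fin m → ℂ} (hv : v ∈ U) (hvk : v ∉ initialSpan m k) :
    Pi.single ⟨k, hk⟩ 1 ∈ U := by
  -- Induction on the number `l` of coordinates that may be nonzero: the block shifts them down.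
  have key : ∀ l, l ≤ m → ∀ v ∈ U, v ∈ initialSpan m l → v ∉ initialSpan m k →
      Pi.single ⟨k, hk⟩ 1 ∈ U := by
    intro l
    induction l with
    | zero => exact fun _ v _ h0 hvk => absurd (fun i _ => h0 i (Nat.zero_le _)) hvk
    | succ l ih =>
      intro hl v hv hvl hvk
      by_cases hvl' : v ∈ initialSpan m l
      · exact ih (by omega) v hv hvl' hvk
      have hvl0 : v ⟨l, hl⟩ ≠ 0 := by
        intro h0
        refine hvl' fun i hi => ?_
        rcases hi.eq_or_lt with hi | hi
        · rw [← h0]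
          exact congrArg v (Fin.ext hi.symm)
        · exact hvl i hi
      have hkl : k ≤ l := by
        by_contra hlt
        exact hvk fun i hi => hvl i (by omega)
      rcases hkl.eq_or_lt with rfl | hkl
      · have hsub : v - v ⟨k, hk⟩ • Pi.single ⟨k, hk⟩ 1 ∈ U := by
          refine hkU fun i hi => ?_
          rcases hi.eq_or_lt with hi | hi
          · obtain rfl : i = ⟨k, hk⟩ := Fin.ext hi.symm
            simp
          · have : i ≠ ⟨k, hk⟩ := by
              rintro rfl
              simp at hi
            simp [this, hvl i hi]
        have := U.sub_mem hv hsub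
        rw [sub_sub_cancel] at this
        exact (U.smul_mem_iff hvl0).1 this
      · refine ih (by omega) _ (hU v hv) (fun i hi => ?_) (fun hmem => hvl0 ?_)
        · by_cases him : (i : ℕ) + 1 < m
          · exact (nilJordanBlock_mulVec_apply v i him).trans (hvl _ (by simp only; omega))
          · exact nilJordanBlock_mulVec_apply_last v i (by omega)
        · obtain ⟨l, rfl⟩ : ∃ r, l = r + 1 := ⟨l - 1, by omega⟩
          rw [← nilJordanBlock_mulVec_apply v l hl]
          exact hmem _ (by simp only; omega)
  exact key m le_rfl v hv (fun i hi => absurd i.2 (by omega)) hvk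

/-- A nilpotent solution of `M J - J M = h(M)` is strictly upper triangular: it stabilises the flag
of `J`. If `M` stabilises the `k`-th member `V`, the preimage of `V` under `M` is stable
under `J` and, `M` being nilpotent, strictly larger than `V`, so it contains the next member. -/
theorem strictUpper_of_isNilpotent {M : Matrix (Fin m) (Fin m) ℂ} (hM : IsNilpotent M) {h : ℂ[X]}
    (h0 : h.coeff 0 = 0) (heq : M * nilJordanBlock m - nilJordanBlock m * M = aeval M h) :
    StrictUpper M := by
  have key : ∀ k, k ≤ m → ∀ b : Fin m, (b : ℕ) < k →
      M.mulVec (Pi.single b 1) ∈ initialSpan m b := by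
    intro k
    induction k with
    | zero => exact fun _ b hb => absurd hb (by omega)
    | succ k ih =>
      intro hk b hb
      have ih := ih (by omega)
      rcases (Nat.lt_succ_iff.1 hb).lt_or_eq with hb | hb
      · exact ih b hb
      obtain rfl : b = ⟨k, hk⟩ := Fin.ext hb
      simp only
      have stable : ∀ v ∈ initialSpan m k, M.mulVec v ∈ initialSpan m k := by
        intro v hv a ha
        rw [Matrix.mulVec, dotProduct]
        refine Finset.sum_eq_zero fun t _ => ?_
        by_cases ht : (t : ℕ) < k
        · have := ih t ht a (by omega)
          rw [Matrix.mulVec_single_one, Matrix.col_apply] at this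
          rw [this, zero_mul]
        · rw [hv t (by omega), mul_zero]
      let U : Submodule ℂ (Fin m → ℂ) := (initialSpan m k).comap M.mulVecLin
      have memU : ∀ v, v ∈ U ↔ M.mulVec v ∈ initialSpan m k := fun v => Iff.rfl
      refine (memU _).1 ?_
      obtain ⟨q, hq⟩ := X_dvd_iff.2 h0
      have stableJ : ∀ v ∈ initialSpan m k,
          (nilJordanBlock m).mulVec v ∈ initialSpan m k := by
        intro v hv i hi
        by_cases him : (i : ℕ) + 1 < m
        · exact (nilJordanBlock_mulVec_apply v i him).trans (hv _ (by simp only; omega))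
        · exact nilJordanBlock_mulVec_apply_last v i (by omega)
      have hUJ : ∀ v ∈ U, (nilJordanBlock m).mulVec v ∈ U := by
        intro v hv
        rw [memU] at hv ⊢
        rw [Matrix.mulVec_mulVec, sub_eq_iff_eq_add.1 heq, hq, Matrix.add_mulVec,
          ← Matrix.mulVec_mulVec, mul_comm X q, map_mul, aeval_X, ← Matrix.mulVec_mulVec]
        exact Submodule.add_mem _ (aeval_mulVec_mem stable q _ hv) (stableJ _ hv)
      -- The last vector `M ^ r e_k` outside the span lies in its preimage.
      obtain ⟨N, hN⟩ := hM
      have hex : ∃ r, (M ^ r).mulVec (Pi.single ⟨k, hk⟩ 1) ∈ initialSpan m k :=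
        ⟨N, by rw [hN, Matrix.zero_mulVec]; exact Submodule.zero_mem _⟩
      classical
      have hr := Nat.find_spec hex
      have hr0 : Nat.find hex ≠ 0 := by
        intro h0
        rw [h0, pow_zero, Matrix.one_mulVec] at hr
        have := hr ⟨k, hk⟩ le_rfl
        simp at this
      obtain ⟨r, hr1⟩ := Nat.exists_eq_succ_of_ne_zero hr0
      refine single_mem_of_nilJordanBlock_stable hUJ hk stable
        (v := (M ^ r).mulVec (Pi.single ⟨k, hk⟩ 1)) ?_ (Nat.find_min hex (by omega))
      rw [memU, Matrix.mulVec_mulVec, ← pow_succ', ← Nat.succ_eq_add_one, ← hr1]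
      exact hr
  intro a b hab
  have := key m le_rfl b b.2 a hab
  rwa [Matrix.mulVec_single_one, Matrix.col_apply] at this

end Triangular

/-! ### Reduction to the Jordan blocks -/

section BlockDiagonal

variable {k : ℕ} {s : Fin k → ℕ}

/-- The Jordan matrix with one block of size `s i` to the eigenvalue `μ i` for each `i`. -/
def jordanMatrix (s : Fin k → ℕ) (μ : Fin k → ℂ) :
    Matrix (Σ i, Fin (s i)) (Σ i, Fin (s i)) ℂ :=
  Matrix.blockDiagonal' fun i => μ i • (1 : Matrix (Fin (s i)) (Fin (s i)) ℂ)
    + nilJordanBlock (s i)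

/-- The block diagonal matrices, as a subspace. -/
def blockDiagonalSubmodule (s : Fin k → ℕ) :
    Submodule ℂ (Matrix (Σ i, Fin (s i)) (Σ i, Fin (s i)) ℂ) where
  carrier := {M | ∀ i j a b, i ≠ j → M ⟨i, a⟩ ⟨j, b⟩ = 0}
  add_mem' := fun hv hw i j a b hij => by
    rw [Matrix.add_apply, hv i j a b hij, hw i j a b hij, add_zero]
  zero_mem' := fun _ _ _ _ _ => rfl
  smul_mem' := fun c v hv i j a b hij => by rw [Matrix.smul_apply, hv i j a b hij, smul_zero]

theorem eq_blockDiagonal'_of_mem {M : Matrix (Σ i, Fin (s i)) (Σ i, Fin (s i)) ℂ}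
    (hM : M ∈ blockDiagonalSubmodule s) :
    M = Matrix.blockDiagonal' (Matrix.blockDiag' M) := by
  ext ⟨i, a⟩ ⟨j, b⟩
  by_cases hij : i = j
  · subst hij
    rw [Matrix.blockDiagonal'_apply_eq, Matrix.blockDiag'_apply]
  · rw [Matrix.blockDiagonal'_apply_ne _ _ _ hij, hM i j a b hij]

/-- The map assembling a block diagonal matrix from its blocks, as an algebra homomorphism. -/
def blockDiagonalAlgHom (s : Fin k → ℕ) :
    (∀ i, Matrix (Fin (s i)) (Fin (s i)) ℂ) →ₐ[ℂ]
      Matrix (Σ i, Fin (s i)) (Σ i, Fin (s i)) ℂ :=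
  { Matrix.blockDiagonal'RingHom (fun i => Fin (s i)) ℂ with
    commutes' := fun c => by
      rw [Algebra.algebraMap_eq_smul_one, Algebra.algebraMap_eq_smul_one]
      exact (Matrix.blockDiagonal'_smul c 1).trans (by rw [Matrix.blockDiagonal'_one]) }

theorem blockDiagonalAlgHom_apply (B : ∀ i, Matrix (Fin (s i)) (Fin (s i)) ℂ) :
    blockDiagonalAlgHom s B = Matrix.blockDiagonal' B := rfl

theorem aeval_blockDiagonal' (B : ∀ i, Matrix (Fin (s i)) (Fin (s i)) ℂ) (h : ℂ[X]) :
    aeval (Matrix.blockDiagonal' B) h = Matrix.blockDiagonal' fun i => aeval (B i) h := by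
  rw [← blockDiagonalAlgHom_apply, aeval_algHom_apply, blockDiagonalAlgHom_apply]
  congr 1
  ext1 i
  exact (aeval_algHom_apply (Pi.evalAlgHom ℂ (fun i => Matrix (Fin (s i)) (Fin (s i)) ℂ) i)
    B h).symm

/-- The Sylvester equation for two Jordan blocks to different eigenvalues has only the trivial
solution. -/
theorem eq_zero_of_jordanBlock_intertwining {m n : ℕ} {W : Matrix (Fin m) (Fin n) ℂ} {x y : ℂ}
    (hxy : x ≠ y) (hW : W * (y • 1 + nilJordanBlock n) = (x • 1 + nilJordanBlock m) * W) :
    W = 0 := by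
  have key : ∀ r, ∀ (a : Fin m) (b : Fin n), (b : ℕ) + (m - (a : ℕ)) = r → W a b = 0 := by
    intro r
    induction r using Nat.strong_induction_on with
    | _ r ih =>
    intro a b hr
    have e := congrFun (congrFun hW a) b
    rw [Matrix.mul_add, Matrix.add_mul, Matrix.add_apply, Matrix.add_apply, Matrix.mul_smul, Matrix.smul_mul,
      Matrix.mul_one, Matrix.one_mul, Matrix.smul_apply, Matrix.smul_apply] at e
    have e1 : (W * nilJordanBlock n) a b = 0 := by
      obtain ⟨b, hb⟩ := b
      rcases b with _ | b
      · rw [mul_nilJordanBlock_apply_zero]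
      · rw [mul_nilJordanBlock_apply_succ, ih _ _ _ _ rfl]
        simp only at hr ⊢
        omega
    have e2 : (nilJordanBlock m * W) a b = 0 := by
      by_cases ha : (a : ℕ) + 1 < m
      · rw [nilJordanBlock_mul_apply W a _ ha, ih _ _ _ _ rfl]
        simp only
        omega
      · rw [nilJordanBlock_mul_apply_last W a _ (by omega)]
    rw [e1, e2, add_zero, add_zero, smul_eq_mul, smul_eq_mul] at e
    have : (x - y) * W a b = 0 := by linear_combination -e
    exact (mul_eq_zero.1 this).resolve_left (sub_ne_zero.2 hxy)
  ext a b
  exact key _ a b rfl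

theorem mul_blockDiagonal'_apply {ι : Type*} (Z : Matrix ι (Σ i, Fin (s i)) ℂ)
    (B : ∀ i, Matrix (Fin (s i)) (Fin (s i)) ℂ) (r : ι) (j : Fin k) (b : Fin (s j)) :
    (Z * Matrix.blockDiagonal' B) r ⟨j, b⟩ = (Z.submatrix id (Sigma.mk j) * B j) r b := by
  rw [Matrix.mul_apply, Matrix.mul_apply, Fintype.sum_sigma, Finset.sum_eq_single j]
  · simp [Matrix.blockDiagonal'_apply_eq]
  · intro l _ hl
    exact Finset.sum_eq_zero fun t _ => by rw [Matrix.blockDiagonal'_apply_ne _ _ _ hl, mul_zero]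
  · simp

theorem blockDiagonal'_mul_apply {ι : Type*} (Z : Matrix (Σ i, Fin (s i)) ι ℂ)
    (B : ∀ i, Matrix (Fin (s i)) (Fin (s i)) ℂ) (i : Fin k) (a : Fin (s i)) (c : ι) :
    (Matrix.blockDiagonal' B * Z) ⟨i, a⟩ c = (B i * Z.submatrix (Sigma.mk i) id) a c := by
  rw [Matrix.mul_apply, Matrix.mul_apply, Fintype.sum_sigma, Finset.sum_eq_single i]
  · simp [Matrix.blockDiagonal'_apply_eq]
  · intro l _ hl
    exact Finset.sum_eq_zero fun t _ => by
      rw [Matrix.blockDiagonal'_apply_ne _ _ _ hl.symm, zero_mul]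
  · simp

theorem mem_blockDiagonalSubmodule_of_commutator {μ : Fin k → ℂ} (hμ : Function.Injective μ)
    {Z : Matrix (Σ i, Fin (s i)) (Σ i, Fin (s i)) ℂ}
    (hZ : Z * jordanMatrix s μ - jordanMatrix s μ * Z ∈ blockDiagonalSubmodule s) :
    Z ∈ blockDiagonalSubmodule s := by
  intro i j a b hij
  have hW := eq_zero_of_jordanBlock_intertwining
    (W := Matrix.of fun (a : Fin (s i)) (b : Fin (s j)) => Z ⟨i, a⟩ ⟨j, b⟩) (hμ.ne hij) (by
      ext a b
      have := hZ i j a b hij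
      rw [Matrix.sub_apply, jordanMatrix, mul_blockDiagonal'_apply, blockDiagonal'_mul_apply,
        Matrix.mul_apply, Matrix.mul_apply, sub_eq_zero] at this
      rw [Matrix.mul_apply, Matrix.mul_apply]
      exact this)
  exact congrFun (congrFun hW a) b

/-- A nilpotent solution is block diagonal. By downward induction on `r` every `M ^ r` is, for its
commutator with the Jordan matrix is a combination of higher powers of `M`. -/
theorem mem_blockDiagonalSubmodule_of_equation {μ : Fin k → ℂ} (hμ : Function.Injective μ)
    {M : Matrix (Σ i, Fin (s i)) (Σ i, Fin (s i)) ℂ} (hM : IsNilpotent M) {h : ℂ[X]}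
    (h0 : h.coeff 0 = 0) (h1 : h.coeff 1 = 0)
    (heq : M * jordanMatrix s μ - jordanMatrix s μ * M = aeval M h) :
    M ∈ blockDiagonalSubmodule s := by
  obtain ⟨N, hN⟩ := hM
  have key : ∀ t r, N ≤ r + 1 + t → M ^ (r + 1) ∈ blockDiagonalSubmodule s := by
    intro t
    induction t with
    | zero =>
      intro r hr
      rw [pow_eq_zero_of_le (by simpa using hr) hN]
      exact Submodule.zero_mem _
    | succ t ih =>
      intro r hr
      apply mem_blockDiagonalSubmodule_of_commutator hμ
      have hc : Commute M (aeval M h) := by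
        have := Commute.all (X : ℂ[X]) h
        simpa using this.map (aeval M)
      have e : M ^ r * aeval M h = aeval M (X ^ r * h) := by simp
      rw [pow_succ_mul_sub_mul_pow_succ heq hc, e, aeval_eq_sum_range]
      refine nsmul_mem (Submodule.sum_mem _ fun l _ => ?_) _
      by_cases hl : l < r + 2
      · have : (X ^ r * h).coeff l = 0 := by
          rw [coeff_X_pow_mul']
          split_ifs with hrl
          · obtain hl | hl : l - r = 0 ∨ l - r = 1 := by omega
            · rw [hl, h0]
            · rw [hl, h1]
          · rfl
        rw [this, zero_smul]
        exact Submodule.zero_mem _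
      · obtain ⟨l, rfl⟩ : ∃ l', l = l' + 1 := ⟨l - 1, by omega⟩
        exact Submodule.smul_mem _ _ (ih l (by omega))
  simpa using key N 0 (by omega)

theorem blockDiagonal'_equation_iff {μ : Fin k → ℂ} {h : ℂ[X]}
    (B : ∀ i, Matrix (Fin (s i)) (Fin (s i)) ℂ) :
    Matrix.blockDiagonal' B * jordanMatrix s μ - jordanMatrix s μ * Matrix.blockDiagonal' B =
        aeval (Matrix.blockDiagonal' B) h ↔
      ∀ i, B i * nilJordanBlock (s i) - nilJordanBlock (s i) * B i = aeval (B i) h := by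
  rw [aeval_blockDiagonal', jordanMatrix, ← Matrix.blockDiagonal'_mul,
    ← Matrix.blockDiagonal'_mul, ← Matrix.blockDiagonal'_sub, Matrix.blockDiagonal'_inj,
    funext_iff]
  refine forall_congr' fun i => ?_
  simp only [Pi.sub_apply]
  rw [mul_add, add_mul, Matrix.mul_smul, Matrix.smul_mul, Matrix.mul_one, Matrix.one_mul,
    add_sub_add_left_eq_sub]

/-- The nilpotent solutions for a Jordan matrix with distinct eigenvalues, parametrised by the last
columns of the blocks. -/
theorem bijOn_blockDiagonal'_jordanSolution {μ : Fin k → ℂ} (hμ : Function.Injective μ) {h : ℂ[X]}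
    (h0 : h.coeff 0 = 0) (h1 : h.coeff 1 = 0) :
    Set.BijOn (fun u : ∀ i, Fin (s i - 1) → ℂ =>
        Matrix.blockDiagonal' fun i => jordanSolution h (u i))
      {u | ∀ i, AdmissibleColumn h (u i)}
      {M | IsNilpotent M ∧ M * jordanMatrix s μ - jordanMatrix s μ * M = aeval M h} := by
  refine ⟨fun u hu => ⟨?_, ?_⟩, fun u _ v _ huv => ?_, ?_⟩
  · choose N hN using fun i => (jordanSolution_strictUpper h (u i)).isNilpotent
    refine ⟨∑ i, N i, ?_⟩
    rw [← Matrix.blockDiagonal'_pow, ← Matrix.blockDiagonal'_zero]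
    congr 1
    ext1 i
    exact pow_eq_zero_of_le (Finset.single_le_sum (fun _ _ => Nat.zero_le _) (Finset.mem_univ i))
      (hN i)
  · exact (blockDiagonal'_equation_iff _).2 fun i => jordanSolution_equation h0 h1 (hu i)
  · have := Matrix.blockDiagonal'_injective huv
    ext i a
    rw [← jordanSolution_apply_last h (u i) a, ← jordanSolution_apply_last h (v i) a,
      congrFun this i]
  · rintro M ⟨hM, heq⟩
    have hB := eq_blockDiagonal'_of_mem (mem_blockDiagonalSubmodule_of_equation hμ hM h0 h1 heq)
    generalize Matrix.blockDiag' M = B at hB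
    subst hB
    rw [blockDiagonal'_equation_iff] at heq
    obtain ⟨N, hN⟩ := hM
    rw [← Matrix.blockDiagonal'_pow, ← Matrix.blockDiagonal'_zero, Matrix.blockDiagonal'_inj] at hN
    have hS : ∀ i, StrictUpper (B i) := fun i =>
      strictUpper_of_isNilpotent ⟨N, congrFun hN i⟩ h0 (heq i)
    refine ⟨fun i a => B i ⟨a, by omega⟩ ⟨s i - 1, by have := a.2; omega⟩,
      fun i => (hS i).admissibleColumn h0 h1 (heq i), ?_⟩
    simp only
    congr 1
    ext1 i
    exact ((hS i).eq_jordanSolution h0 h1 (heq i)).symm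

end BlockDiagonal

/-! ### Conjugation to Jordan form -/

section Conjugation

/-- Conjugation `B ↦ P B Q` by a pair of mutually inverse matrices. -/
def conjugationAlgEquiv {ι κ : Type*} [Fintype ι] [DecidableEq ι] [Fintype κ] [DecidableEq κ]
    (P : Matrix ι κ ℂ) (Q : Matrix κ ι ℂ) (hPQ : P * Q = 1) (hQP : Q * P = 1) :
    Matrix κ κ ℂ ≃ₐ[ℂ] Matrix ι ι ℂ where
  toFun B := P * B * Q
  invFun M := Q * M * P
  left_inv B := by
    calc Q * (P * B * Q) * P = (Q * P) * B * (Q * P) := by simp only [Matrix.mul_assoc]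
      _ = B := by rw [hQP, Matrix.one_mul, Matrix.mul_one]
  right_inv M := by
    calc P * (Q * M * P) * Q = (P * Q) * M * (P * Q) := by simp only [Matrix.mul_assoc]
      _ = M := by rw [hPQ, Matrix.one_mul, Matrix.mul_one]
  map_mul' B C := by
    calc P * (B * C) * Q = P * B * (1 : Matrix κ κ ℂ) * C * Q := by
          simp only [Matrix.mul_assoc, Matrix.one_mul]
      _ = P * B * Q * (P * C * Q) := by rw [← hQP]; simp only [Matrix.mul_assoc]
  map_add' B C := by rw [Matrix.mul_add, Matrix.add_mul]
  commutes' c := by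
    rw [Algebra.algebraMap_eq_smul_one, Algebra.algebraMap_eq_smul_one, Matrix.mul_smul,
      Matrix.smul_mul, Matrix.mul_one, hPQ]

/-- An algebra isomorphism carries the nilpotent solutions for `D` to those for its image. -/
theorem bijOn_nilpotent_solutions {R S : Type*} [Ring R] [Ring S] [Algebra ℂ R] [Algebra ℂ S]
    (φ : R ≃ₐ[ℂ] S) (D : R) (h : ℂ[X]) :
    Set.BijOn φ {M | IsNilpotent M ∧ M * D - D * M = aeval M h}
      {M | IsNilpotent M ∧ M * φ D - φ D * M = aeval M h} := by
  have key : ∀ M, (IsNilpotent (φ M) ∧ φ M * φ D - φ D * φ M = aeval (φ M) h) ↔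
      (IsNilpotent M ∧ M * D - D * M = aeval M h) := by
    intro M
    rw [IsNilpotent.map_iff φ.injective, aeval_algHom_apply φ M h, ← map_mul, ← map_mul, ← map_sub]
    exact and_congr_right' φ.injective.eq_iff
  refine ⟨fun M hM => (key M).2 hM, φ.injective.injOn, fun N hN => ?_⟩
  refine ⟨φ.symm N, (key _).1 ?_, φ.apply_symm_apply N⟩
  rw [φ.apply_symm_apply]
  exact hN

variable {n k : ℕ} {A : Matrix (Fin n) (Fin n) ℂ} {s : Fin k → ℕ} {μ : Fin k → ℂ}
  {P : Matrix (Fin n) (Σ i, Fin (s i)) ℂ} {Q : Matrix (Σ i, Fin (s i)) (Fin n) ℂ}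

theorem IsJordanReduction.conjugation_jordanMatrix (H : IsJordanReduction A s μ P Q) :
    conjugationAlgEquiv P Q H.mul_inv H.inv_mul (jordanMatrix s μ) = A := by
  rw [jordanMatrix, ← H.conj_eq]
  exact (conjugationAlgEquiv P Q H.mul_inv H.inv_mul).apply_symm_apply A

theorem IsJordanReduction.mul_eq (H : IsJordanReduction A s μ P Q) :
    A * P = P * jordanMatrix s μ := by
  rw [jordanMatrix, ← H.conj_eq, ← Matrix.mul_assoc, ← Matrix.mul_assoc, H.mul_inv, Matrix.one_mul]

theorem IsJordanReduction.sum_size (H : IsJordanReduction A s μ P Q) : ∑ i, s i = n := by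
  have := Matrix.trace_mul_comm P Q
  rw [H.mul_inv, H.inv_mul, Matrix.trace_one, Matrix.trace_one] at this
  have := Nat.cast_injective this
  simpa using this.symm

theorem IsJordanReduction.bijOn_solutionOf (H : IsJordanReduction A s μ P Q)
    (hμ : Function.Injective μ) {h : ℂ[X]} (h0 : h.coeff 0 = 0) (h1 : h.coeff 1 = 0) :
    Set.BijOn (fun u : ∀ i, Fin (s i - 1) → ℂ => solutionOf P Q h u)
      {u | ∀ i, AdmissibleColumn h (u i)}
      {M | IsNilpotent M ∧ M * A - A * M = aeval M h} := by
  have := bijOn_nilpotent_solutions (conjugationAlgEquiv P Q H.mul_inv H.inv_mul)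
    (jordanMatrix s μ) h
  rw [H.conjugation_jordanMatrix] at this
  exact this.comp (bijOn_blockDiagonal'_jordanSolution hμ h0 h1)

theorem IsJordanReduction.finrank_parameters (H : IsJordanReduction A s μ P Q) :
    Module.finrank ℂ (∀ i, Fin (s i - 1) → ℂ) + k = n := by
  rw [Module.finrank_pi_fintype, ← H.sum_size]
  simp only [Module.finrank_fin_fun]
  calc ∑ i, (s i - 1) + k = ∑ i, (s i - 1) + ∑ _i : Fin k, 1 := by simp
    _ = ∑ i, (s i - 1 + 1) := Finset.sum_add_distrib.symm
    _ = ∑ i, s i := Finset.sum_congr rfl fun i _ => Nat.sub_add_cancel (H.size_pos i)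

end Conjugation

/-! ### Fields containing the entries -/

section Entries

variable {F : IntermediateField ℚ ℂ} {ι κ τ : Type*}

theorem entrySet_subset_iff {M : Matrix ι κ ℂ} {S : Set ℂ} :
    entrySet M ⊆ S ↔ ∀ i j, M i j ∈ S :=
  ⟨fun H i j => H ⟨i, j, rfl⟩, by rintro H _ ⟨i, j, rfl⟩; exact H i j⟩

theorem mul_apply_mem [Fintype κ] {M : Matrix ι κ ℂ} {N : Matrix κ τ ℂ} (hM : ∀ i j, M i j ∈ F)
    (hN : ∀ i j, N i j ∈ F) (i : ι) (j : τ) : (M * N) i j ∈ F := by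
  rw [Matrix.mul_apply]
  exact sum_mem fun t _ => mul_mem (hM i t) (hN t j)

/-- The matrices with entries in `F`, as a subring. -/
def entrySubring (F : IntermediateField ℚ ℂ) (ι : Type*) [Fintype ι] [DecidableEq ι] :
    Subring (Matrix ι ι ℂ) :=
  F.toSubfield.toSubring.matrix

theorem mem_entrySubring [Fintype ι] [DecidableEq ι] {M : Matrix ι ι ℂ} :
    M ∈ entrySubring F ι ↔ ∀ i j, M i j ∈ F := Iff.rfl

theorem aeval_apply_mem [Fintype ι] [DecidableEq ι] {M : Matrix ι ι ℂ} (hM : ∀ i j, M i j ∈ F)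
    {h : ℂ[X]} (hh : ∀ l, h.coeff l ∈ F) (i j : ι) : (aeval M h) i j ∈ F := by
  rw [aeval_eq_sum_range, Matrix.sum_apply]
  refine sum_mem fun l _ => ?_
  rw [Matrix.smul_apply]
  exact mul_mem (hh l) (mem_entrySubring.1 (pow_mem (mem_entrySubring.2 hM) l) i j)

theorem det_mem [Fintype ι] [DecidableEq ι] {M : Matrix ι ι ℂ} (hM : ∀ i j, M i j ∈ F) :
    M.det ∈ F := by
  rw [Matrix.det_apply]
  refine sum_mem fun σ _ => ?_
  rw [Units.smul_def]
  exact zsmul_mem (prod_mem fun i _ => hM _ _) _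

theorem inv_apply_mem [Fintype ι] [DecidableEq ι] {M : Matrix ι ι ℂ} (hM : ∀ i j, M i j ∈ F)
    (i j : ι) : M⁻¹ i j ∈ F := by
  rw [Matrix.inv_def, Matrix.smul_apply, Ring.inverse_eq_inv, Matrix.adjugate_apply]
  refine mul_mem (inv_mem (det_mem hM)) (det_mem fun a b => ?_)
  rw [Matrix.updateRow_apply]
  split_ifs
  · rw [Pi.single_apply]
    split_ifs
    · exact one_mem _
    · exact zero_mem _
  · exact hM a b

theorem inverse_apply_mem [Fintype ι] [DecidableEq ι] [Fintype κ] [DecidableEq κ] (e : ι ≃ κ)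
    {P : Matrix ι κ ℂ} {Q : Matrix κ ι ℂ} (hPQ : P * Q = 1) (hP : ∀ i j, P i j ∈ F) (i : κ)
    (j : ι) : Q i j ∈ F := by
  have : (P.submatrix id e) * (Q.submatrix e id) = 1 := by
    rw [Matrix.submatrix_mul_equiv, hPQ, Matrix.submatrix_id_id]
  have h := inv_apply_mem (F := F) (M := P.submatrix id e) (fun a b => hP a (e b)) (e.symm i) j
  rw [Matrix.inv_eq_right_inv this] at h
  simpa using h

theorem jordanSolution_apply_mem {m : ℕ} {h : ℂ[X]} (hh : ∀ l, h.coeff l ∈ F)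
    {u : Fin (m - 1) → ℂ} (hu : ∀ a, u a ∈ F) (i j : Fin m) : jordanSolution h u i j ∈ F := by
  -- Induction along the order in which the entries are computed.
  have key : ∀ d r : ℕ, ∀ i j : Fin m, (j : ℕ) - (i : ℕ) = d → m - (i : ℕ) = r →
      jordanSolution h u i j ∈ F := by
    intro d
    induction d using Nat.strong_induction_on with
    | _ d ihd =>
    intro r
    induction r using Nat.strong_induction_on with
    | _ r ihr =>
    intro i j hd hr
    by_cases hij : (i : ℕ) < (j : ℕ)
    swap
    · rw [jordanSolution_strictUpper h u i j (by omega)]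
      exact zero_mem _
    have prec : ∀ a b : Fin m, ((b : ℕ) - (a : ℕ) < (j : ℕ) - (i : ℕ) ∨
        ((b : ℕ) - (a : ℕ) = (j : ℕ) - (i : ℕ) ∧ (i : ℕ) < (a : ℕ))) →
        jordanSolution h u a b ∈ F := by
      rintro a b (hab | ⟨hab, hia⟩)
      · exact ihd _ (by omega) _ a b rfl rfl
      · exact ihr (m - a) (by omega) a b (by omega) rfl
    by_cases hj : (j : ℕ) + 1 < m
    · rw [jordanSolution_apply h u hij hj]
      refine div_mem (add_mem (prec _ _ (by simp only; omega)) (aeval_apply_mem (fun a b => ?_) hh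
        _ _)) (sub_mem (one_mem _) (mul_mem (hh 2) (prec _ _ (by simp only; omega))))
      rw [precedingPart, Matrix.of_apply]
      split_ifs with hab
      · exact prec a b hab
      · exact zero_mem _
    · have hj' : j = ⟨m - 1, by omega⟩ := Fin.ext (by simp only; omega)
      rw [hj', jordanSolution_apply_last h u ⟨i, by omega⟩]
      exact hu _
  exact key _ _ i j rfl rfl

theorem IsJordanReduction.solutionOf_apply_mem {n k : ℕ} {A : Matrix (Fin n) (Fin n) ℂ}
    {s : Fin k → ℕ} {μ : Fin k → ℂ} {P : Matrix (Fin n) (Σ i, Fin (s i)) ℂ}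
    {Q : Matrix (Σ i, Fin (s i)) (Fin n) ℂ} (H : IsJordanReduction A s μ P Q)
    (hP : ∀ i j, P i j ∈ F) {h : ℂ[X]} (hh : ∀ l, h.coeff l ∈ F)
    {u : ∀ i, Fin (s i - 1) → ℂ} (hu : ∀ i a, u i a ∈ F) (i j : Fin n) :
    solutionOf P Q h u i j ∈ F := by
  have e : Fin n ≃ Σ i, Fin (s i) := Fintype.equivOfCardEq (by simp [H.sum_size])
  refine mul_apply_mem (mul_apply_mem hP ?_) (inverse_apply_mem e H.mul_inv hP) i j
  rintro ⟨a, b⟩ ⟨c, d⟩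
  rw [Matrix.blockDiagonal'_apply]
  split_ifs
  · exact jordanSolution_apply_mem hh (hu a) _ _
  · exact zero_mem _

end Entries

/-! ### Jordan bases over the field of the entries and eigenvalues -/

section RationalBasis

variable {k : ℕ} {s : Fin k → ℕ} {μ : Fin k → ℂ}

theorem mul_jordanMatrix_apply_zero {ι : Type*} (P : Matrix ι (Σ i, Fin (s i)) ℂ) (r : ι)
    (i : Fin k) (hi : 0 < s i) :
    (P * jordanMatrix s μ) r ⟨i, ⟨0, hi⟩⟩ = μ i * P r ⟨i, ⟨0, hi⟩⟩ := by
  rw [jordanMatrix, mul_blockDiagonal'_apply, Matrix.mul_add, Matrix.add_apply,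
    mul_nilJordanBlock_apply_zero, Matrix.mul_smul, Matrix.mul_one]
  simp

theorem mul_jordanMatrix_apply_succ {ι : Type*} (P : Matrix ι (Σ i, Fin (s i)) ℂ) (r : ι)
    (i : Fin k) (b : ℕ) (hb : b + 1 < s i) :
    (P * jordanMatrix s μ) r ⟨i, ⟨b + 1, hb⟩⟩ =
      μ i * P r ⟨i, ⟨b + 1, hb⟩⟩ + P r ⟨i, ⟨b, by omega⟩⟩ := by
  rw [jordanMatrix, mul_blockDiagonal'_apply, Matrix.mul_add, Matrix.add_apply,
    mul_nilJordanBlock_apply_succ, Matrix.mul_smul, Matrix.mul_one]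
  simp

/-- For distinct eigenvalues, the eigenvectors of the Jordan matrix are the multiples of the first
basis vectors of the blocks. -/
theorem eq_single_of_jordanMatrix_eigenvector (hμ : Function.Injective μ)
    {w : (Σ i, Fin (s i)) → ℂ} {x : ℂ} (hw : (jordanMatrix s μ).mulVec w = x • w) (hw0 : w ≠ 0) :
    ∃ (i : Fin k) (hi : 0 < s i), w = w ⟨i, ⟨0, hi⟩⟩ • Pi.single ⟨i, ⟨0, hi⟩⟩ 1 := by
  have e : ∀ (i : Fin k) (a : Fin (s i)), x * w ⟨i, a⟩ = μ i * w ⟨i, a⟩ +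
      (nilJordanBlock (s i) * Matrix.of fun (a : Fin (s i)) (_ : Unit) => w ⟨i, a⟩) a () := by
    intro i a
    have h1 : (jordanMatrix s μ * Matrix.of fun y (_ : Unit) => w y) ⟨i, a⟩ () = x * w ⟨i, a⟩ :=
      congrFun hw ⟨i, a⟩
    rw [jordanMatrix, blockDiagonal'_mul_apply, Matrix.add_mul, Matrix.add_apply, Matrix.smul_mul,
      Matrix.one_mul] at h1
    exact h1.symm
  have zero_of_ne : ∀ i, μ i ≠ x → ∀ a, w ⟨i, a⟩ = 0 := by
    intro i hi
    have key : ∀ t, ∀ a : Fin (s i), s i - (a : ℕ) = t → w ⟨i, a⟩ = 0 := by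
      intro t
      induction t with
      | zero => intro a ha; omega
      | succ t ih =>
        intro a ha
        have h2 := e i a
        have h3 : (nilJordanBlock (s i) *
            Matrix.of fun (a : Fin (s i)) (_ : Unit) => w ⟨i, a⟩) a () = 0 := by
          by_cases ha1 : (a : ℕ) + 1 < s i
          · rw [nilJordanBlock_mul_apply _ a _ ha1]
            exact ih _ (by simp only; omega)
          · exact nilJordanBlock_mul_apply_last _ a _ (by omega)
        rw [h3, add_zero] at h2
        have h4 : (μ i - x) * w ⟨i, a⟩ = 0 := by linear_combination -h2
        exact (mul_eq_zero.1 h4).resolve_left (sub_ne_zero.2 hi)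
    exact fun a => key _ a rfl
  have zero_of_pos : ∀ i a (ha : a + 1 < s i), w ⟨i, ⟨a + 1, ha⟩⟩ = 0 := by
    intro i a ha
    by_cases hi : μ i = x
    · have h2 := e i ⟨a, by omega⟩
      rw [nilJordanBlock_mul_apply _ a _ ha, hi] at h2
      simpa using h2
    · exact zero_of_ne i hi _
  obtain ⟨⟨i, a⟩, hia⟩ := Function.ne_iff.1 hw0
  have hi : μ i = x := by
    by_contra h
    exact hia (zero_of_ne i h a)
  refine ⟨i, by have := a.2; omega, ?_⟩
  ext ⟨j, b, hb⟩
  by_cases hij : j = i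
  · subst hij
    rcases b with _ | b
    · simp
    · rw [zero_of_pos]
      simp
  · rw [zero_of_ne j (fun h => hij (hμ (h.trans hi.symm)))]
    simp [hij]

theorem aeval_jordanMatrix_prod : aeval (jordanMatrix s μ) (∏ i, (X - C (μ i)) ^ s i) = 0 := by
  rw [jordanMatrix, aeval_blockDiagonal', ← Matrix.blockDiagonal'_zero]
  congr 1
  ext1 i
  obtain ⟨q, hq⟩ := Finset.dvd_prod_of_mem (fun i => (X - C (μ i)) ^ s i) (Finset.mem_univ i)
  have hN : StrictUpper (nilJordanBlock (s i)) := by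
    intro a b hab
    rw [nilJordanBlock, Matrix.of_apply, if_neg (by omega)]
  have hN0 : nilJordanBlock (s i) ^ s i = 0 := by
    ext a b
    exact hN.pow_apply_eq_zero _ a b (by omega)
  rw [hq, map_mul, map_pow, map_sub, aeval_X, aeval_C, Algebra.algebraMap_eq_smul_one,
    add_sub_cancel_left, hN0, zero_mul]
  rfl

theorem aeval_mulVec_of_eigenvector {ι : Type*} [Fintype ι] [DecidableEq ι] {A : Matrix ι ι ℂ}
    {v : ι → ℂ} {x : ℂ} (hv : A.mulVec v = x • v) (q : ℂ[X]) :
    (aeval A q).mulVec v = q.eval x • v := by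
  induction q using Polynomial.induction_on with
  | C a => rw [aeval_C, Algebra.algebraMap_eq_smul_one, Matrix.smul_mulVec, Matrix.one_mulVec,
      eval_C]
  | add p q hp hq => rw [map_add, Matrix.add_mulVec, hp, hq, eval_add, add_smul]
  | monomial n a ih =>
    rw [pow_succ, ← mul_assoc, map_mul, aeval_X, ← Matrix.mulVec_mulVec, hv, Matrix.mulVec_smul,
      ih, smul_smul, eval_mul (q := X), eval_X, mul_comm]

variable {n : ℕ} {A : Matrix (Fin n) (Fin n) ℂ} {P : Matrix (Fin n) (Σ i, Fin (s i)) ℂ}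
  {Q : Matrix (Σ i, Fin (s i)) (Fin n) ℂ}

theorem IsJordanReduction.aeval_prod (H : IsJordanReduction A s μ P Q) :
    aeval A (∏ i, (X - C (μ i)) ^ s i) = 0 := by
  rw [← H.conjugation_jordanMatrix, aeval_algHom_apply, aeval_jordanMatrix_prod, map_zero]

theorem IsJordanReduction.col_zero_ne_zero (H : IsJordanReduction A s μ P Q) (i : Fin k) :
    (P.col ⟨i, ⟨0, H.size_pos i⟩⟩) ≠ 0 := by
  intro h
  have h1 := congrFun (congrFun H.inv_mul ⟨i, ⟨0, H.size_pos i⟩⟩) ⟨i, ⟨0, H.size_pos i⟩⟩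
  rw [Matrix.one_apply_eq, Matrix.mul_apply, Finset.sum_eq_zero] at h1
  · exact zero_ne_one h1
  · intro t _
    have := congrFun h t
    rw [Matrix.col_apply] at this
    rw [this, Pi.zero_apply, mul_zero]

theorem mulVec_col_zero_of_mul_eq (H : A * P = P * jordanMatrix s μ) (i : Fin k) (hi : 0 < s i) :
    A.mulVec (P.col ⟨i, ⟨0, hi⟩⟩) = μ i • P.col ⟨i, ⟨0, hi⟩⟩ := by
  ext r
  have := congrFun (congrFun H r) ⟨i, ⟨0, hi⟩⟩
  rw [mul_jordanMatrix_apply_zero] at this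
  exact this

/-- The product of the factors `(X - μ j) ^ s j` with `j ≠ i`. For distinct `μ j`, this is the
minimal polynomial of the Jordan matrix without the factors `X - μ i`. -/
def cofactor (s : Fin k → ℕ) (μ : Fin k → ℂ) (i : Fin k) : ℂ[X] :=
  ∏ j ∈ Finset.univ.erase i, (X - C (μ j)) ^ s j

theorem cofactor_eval_ne_zero (hμ : Function.Injective μ) (i : Fin k) :
    (cofactor s μ i).eval (μ i) ≠ 0 := by
  rw [cofactor, eval_prod, Finset.prod_ne_zero_iff]
  intro j hj
  rw [eval_pow, eval_sub, eval_X, eval_C]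
  exact pow_ne_zero _ (sub_ne_zero.2 (hμ.ne (Finset.ne_of_mem_erase hj).symm))

/-- The minimal polynomial of the Jordan matrix, divided by `X - μ i`, does not annihilate `A`: it
does not annihilate the last vector of the `i`-th Jordan chain. -/
theorem IsJordanReduction.aeval_cofactor_mul_ne_zero (H : IsJordanReduction A s μ P Q)
    (hμ : Function.Injective μ) (i : Fin k) :
    aeval A (cofactor s μ i * (X - C (μ i)) ^ (s i - 1)) ≠ 0 := by
  have chain : ∀ b (hb : b < s i), (aeval A ((X - C (μ i)) ^ b)).mulVec (P.col ⟨i, ⟨b, hb⟩⟩) =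
      P.col ⟨i, ⟨0, H.size_pos i⟩⟩ := by
    intro b
    induction b with
    | zero => intro hb; simp
    | succ b ih =>
      intro hb
      rw [pow_succ, map_mul, ← Matrix.mulVec_mulVec, ← ih (by omega)]
      congr 1
      ext r
      have := congrFun (congrFun H.mul_eq r) ⟨i, ⟨b + 1, hb⟩⟩
      rw [mul_jordanMatrix_apply_succ] at this
      rw [map_sub, aeval_X, aeval_C, Algebra.algebraMap_eq_smul_one, Matrix.sub_mulVec,
        Matrix.smul_mulVec, Matrix.one_mulVec, Pi.sub_apply, Pi.smul_apply, smul_eq_mul,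
        Matrix.col_apply, Matrix.col_apply, sub_eq_iff_eq_add']
      exact this
  intro h
  have hlast : s i - 1 < s i := Nat.sub_lt (H.size_pos i) one_pos
  refine smul_ne_zero (cofactor_eval_ne_zero (s := s) hμ i) (H.col_zero_ne_zero i) ?_
  rw [← aeval_mulVec_of_eigenvector (mulVec_col_zero_of_mul_eq H.mul_eq i _), ← chain _ hlast,
    Matrix.mulVec_mulVec, ← map_mul, h, Matrix.zero_mulVec]

/-- An intertwiner `P` whose first columns in the blocks do not vanish is injective: its kernel is
stable under the Jordan matrix, so it would contain an eigenvector. -/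
theorem mulVec_injective_of_intertwining (hμ : Function.Injective μ)
    (H : A * P = P * jordanMatrix s μ) (hP : ∀ i (hi : 0 < s i), P.col ⟨i, ⟨0, hi⟩⟩ ≠ 0) :
    Function.Injective P.mulVec := by
  have hker : LinearMap.ker P.mulVecLin = ⊥ := by
    by_contra hne
    have hnt : Nontrivial (LinearMap.ker P.mulVecLin) := Submodule.nontrivial_iff_ne_bot.2 hne
    have hstable : ∀ w ∈ LinearMap.ker P.mulVecLin,
        (jordanMatrix s μ).mulVecLin w ∈ LinearMap.ker P.mulVecLin := by
      intro w hw
      rw [LinearMap.mem_ker, Matrix.mulVecLin_apply] at hw ⊢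
      rw [Matrix.mulVecLin_apply, Matrix.mulVec_mulVec, ← H, ← Matrix.mulVec_mulVec, hw,
        Matrix.mulVec_zero]
    obtain ⟨x, hx⟩ := Module.End.exists_eigenvalue ((jordanMatrix s μ).mulVecLin.restrict hstable)
    obtain ⟨w, hw⟩ := hx.exists_hasEigenvector
    have hwe : (jordanMatrix s μ).mulVec (w : (Σ i, Fin (s i)) → ℂ) = x • (w : _ → ℂ) :=
      congrArg Subtype.val hw.apply_eq_smul
    have hw0 : (w : (Σ i, Fin (s i)) → ℂ) ≠ 0 := fun h => hw.2 (Subtype.ext h)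
    obtain ⟨i, hi, hwi⟩ := eq_single_of_jordanMatrix_eigenvector hμ hwe hw0
    have hPw : P.mulVec (w : (Σ i, Fin (s i)) → ℂ) = 0 := w.2
    rw [hwi, Matrix.mulVec_smul, Matrix.mulVec_single_one] at hPw
    rcases smul_eq_zero.1 hPw with h | h
    · rw [h, zero_smul] at hwi
      exact hw0 hwi
    · exact hP i hi h
  exact LinearMap.ker_eq_bot.1 hker

/-- An injective intertwiner of the right size is the first matrix of a Jordan reduction. -/
theorem exists_isJordanReduction_of_injective (hs : ∀ i, 0 < s i) (hn : ∑ i, s i = n)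
    (H : A * P = P * jordanMatrix s μ) (hP : Function.Injective P.mulVec) :
    ∃ Q, IsJordanReduction A s μ P Q := by
  let e : Fin n ≃ Σ i, Fin (s i) := Fintype.equivOfCardEq (by simp [hn])
  have hR : IsUnit (P.submatrix id e) := by
    rw [← Matrix.mulVec_injective_iff_isUnit]
    intro v w hvw
    have key : ∀ v : Fin n → ℂ, (P.submatrix id e).mulVec v = P.mulVec (v ∘ e.symm) := by
      intro v
      rw [Matrix.submatrix_mulVec_equiv]
      rfl
    simp only [key] at hvw
    have := hP hvw
    ext a
    simpa using congrFun this (e a)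
  have hdet := (Matrix.isUnit_iff_isUnit_det _).1 hR
  have hPQ : P * (P.submatrix id e)⁻¹.submatrix e.symm id = 1 := by
    have := Matrix.mul_nonsing_inv _ hdet
    rw [← this]
    ext a b
    rw [Matrix.mul_apply, Matrix.mul_apply, ← e.sum_comp]
    simp
  have hQP : (P.submatrix id e)⁻¹.submatrix e.symm id * P = 1 := by
    rwa [Matrix.mul_eq_one_comm_of_equiv e.symm]
  refine ⟨_, hs, hPQ, hQP, ?_⟩
  rw [Matrix.mul_assoc, H, ← Matrix.mul_assoc, hQP, Matrix.one_mul, jordanMatrix]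

/-- Jordan chains can be chosen in every field containing the entries of `A` and the eigenvalues:
some column of `q(A)`, where `q` is the cofactor of `(X - μ i) ^ s i` in the minimal polynomial,
is killed by `(A - μ i) ^ s i` but not by `(A - μ i) ^ (s i - 1)`. -/
theorem IsJordanReduction.exists_entries_mem (H : IsJordanReduction A s μ P Q)
    (hμ : Function.Injective μ) {F : IntermediateField ℚ ℂ} (hA : ∀ i j, A i j ∈ F)
    (hμF : ∀ i, μ i ∈ F) :
    ∃ (P' : Matrix (Fin n) (Σ i, Fin (s i)) ℂ) (Q' : Matrix (Σ i, Fin (s i)) (Fin n) ℂ),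
      IsJordanReduction A s μ P' Q' ∧ ∀ i j, P' i j ∈ F := by
  have hcol : ∀ i, ∃ c, (aeval A (cofactor s μ i * (X - C (μ i)) ^ (s i - 1))).col c ≠ 0 := by
    intro i
    by_contra! h
    refine H.aeval_cofactor_mul_ne_zero hμ i ?_
    ext a b
    exact congrFun (h b) a
  choose c hc using hcol
  let P' : Matrix (Fin n) (Σ i, Fin (s i)) ℂ := Matrix.of fun r x =>
    (aeval A (cofactor s μ x.1 * (X - C (μ x.1)) ^ (s x.1 - 1 - (x.2 : ℕ)))) r (c x.1)
  have hP'F : ∀ r x, P' r x ∈ F := by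
    rintro r ⟨i, a⟩
    have hfac : ∀ j, aeval A (X - C (μ j)) ∈ entrySubring F (Fin n) := by
      intro j
      rw [map_sub, aeval_X, aeval_C, mem_entrySubring]
      intro a b
      refine sub_mem (hA a b) ?_
      rw [Matrix.algebraMap_matrix_apply]
      split_ifs
      · exact hμF j
      · exact zero_mem _
    have : cofactor s μ i * (X - C (μ i)) ^ (s i - 1 - (a : ℕ)) ∈
        (entrySubring F (Fin n)).comap (aeval A : ℂ[X] →ₐ[ℂ] Matrix (Fin n) (Fin n) ℂ).toRingHom :=
      mul_mem (prod_mem fun j _ => pow_mem (Subring.mem_comap.2 (hfac j)) _)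
        (pow_mem (Subring.mem_comap.2 (hfac i)) _)
    exact mem_entrySubring.1 (Subring.mem_comap.1 this) r _
  have step : ∀ i l, A * aeval A (cofactor s μ i * (X - C (μ i)) ^ l) =
      μ i • aeval A (cofactor s μ i * (X - C (μ i)) ^ l) +
        aeval A (cofactor s μ i * (X - C (μ i)) ^ (l + 1)) := by
    intro i l
    have e1 : cofactor s μ i * (X - C (μ i)) ^ (l + 1) =
        (X - C (μ i)) * (cofactor s μ i * (X - C (μ i)) ^ l) := by ring
    rw [e1, map_mul (aeval A) (X - C (μ i)), map_sub, aeval_X, aeval_C, Algebra.algebraMap_eq_smul_one, sub_mul,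
      smul_mul_assoc, one_mul, add_sub_cancel]
  have hint : A * P' = P' * jordanMatrix s μ := by
    ext r ⟨i, b, hb⟩
    have e1 : (A * P') r ⟨i, ⟨b, hb⟩⟩ =
        (A * aeval A (cofactor s μ i * (X - C (μ i)) ^ (s i - 1 - b))) r (c i) := rfl
    rw [e1, step, Matrix.add_apply, Matrix.smul_apply, smul_eq_mul]
    rcases b with _ | b
    · have hs : s i - 1 - 0 + 1 = s i := by omega
      have h0 : cofactor s μ i * (X - C (μ i)) ^ s i = ∏ j, (X - C (μ j)) ^ s j :=
        Finset.prod_erase_mul _ _ (Finset.mem_univ i)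
      rw [hs, h0, H.aeval_prod, mul_jordanMatrix_apply_zero, Matrix.zero_apply, add_zero]
      rfl
    · have hs : s i - 1 - (b + 1) + 1 = s i - 1 - b := by omega
      rw [hs, mul_jordanMatrix_apply_succ]
      rfl
  obtain ⟨Q', hQ'⟩ := exists_isJordanReduction_of_injective H.size_pos H.sum_size hint
    (mulVec_injective_of_intertwining hμ hint fun i _ => hc i)
  exact ⟨P', Q', hQ', hP'F⟩

end RationalBasis

/-! ### Enumerating the eigenvalues -/

section Eigenvalues

variable {n k : ℕ} {A : Matrix (Fin n) (Fin n) ℂ} {s : Fin k → ℕ} {μ : Fin k → ℂ}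
  {P : Matrix (Fin n) (Σ i, Fin (s i)) ℂ} {Q : Matrix (Σ i, Fin (s i)) (Fin n) ℂ}

theorem IsJordanReduction.mem_spectrum (H : IsJordanReduction A s μ P Q) (i : Fin k) :
    μ i ∈ spectrum ℂ A := by
  rw [spectrum.mem_iff]
  intro hu
  have hinj := Matrix.mulVec_injective_of_isUnit hu
  refine H.col_zero_ne_zero i (hinj ?_)
  rw [Matrix.mulVec_zero, Matrix.sub_mulVec, Algebra.algebraMap_eq_smul_one, Matrix.smul_mulVec,
    Matrix.one_mulVec, mulVec_col_zero_of_mul_eq H.mul_eq i (H.size_pos i), sub_self]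

theorem IsJordanReduction.reindex {l : ℕ} (H : IsJordanReduction A s μ P Q) (σ : Fin l ≃ Fin k) :
    IsJordanReduction A (s ∘ σ) (μ ∘ σ)
      (P.submatrix id (Equiv.sigmaCongrLeft (β := fun i => Fin (s i)) σ))
      (Q.submatrix (Equiv.sigmaCongrLeft (β := fun i => Fin (s i)) σ) id) where
  size_pos i := H.size_pos (σ i)
  mul_inv := by rw [Matrix.submatrix_mul_equiv, H.mul_inv, Matrix.submatrix_id_id]
  inv_mul := by
    have := Matrix.submatrix_mul Q P (Equiv.sigmaCongrLeft (β := fun i => Fin (s i)) σ) id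
      (Equiv.sigmaCongrLeft (β := fun i => Fin (s i)) σ) Function.bijective_id
    rw [← this, H.inv_mul, Matrix.submatrix_one_equiv]
  conj_eq := by
    have h1 := Matrix.submatrix_mul Q A (Equiv.sigmaCongrLeft (β := fun i => Fin (s i)) σ) id
      id Function.bijective_id
    have h2 := Matrix.submatrix_mul (Q * A) P (Equiv.sigmaCongrLeft (β := fun i => Fin (s i)) σ) id
      (Equiv.sigmaCongrLeft (β := fun i => Fin (s i)) σ) Function.bijective_id
    rw [Matrix.submatrix_id_id] at h1
    rw [← h1, ← h2, H.conj_eq]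
    have e : ∀ (i : Fin l) (a : Fin (s (σ i))),
        Equiv.sigmaCongrLeft (β := fun i => Fin (s i)) σ ⟨i, a⟩ = ⟨σ i, a⟩ := fun _ _ => rfl
    ext ⟨i, a⟩ ⟨j, b⟩
    rw [Matrix.submatrix_apply, e, e]
    by_cases hij : i = j
    · subst hij
      rw [Matrix.blockDiagonal'_apply_eq, Matrix.blockDiagonal'_apply_eq]
      rfl
    · rw [Matrix.blockDiagonal'_apply_ne _ _ _ (σ.injective.ne hij),
        Matrix.blockDiagonal'_apply_ne _ _ _ hij]

/-- The Jordan form of a non-derogatory matrix may be written with any enumeration of its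
eigenvalues. -/
theorem NonDerogatory.exists_isJordanReduction (hA : NonDerogatory A) {lam : Fin k → ℂ}
    (hlam : Function.Injective lam) (hspec : Set.range lam = spectrum ℂ A) :
    ∃ (α : Fin k → ℕ) (P : Matrix (Fin n) (Σ i, Fin (α i)) ℂ)
      (Q : Matrix (Σ i, Fin (α i)) (Fin n) ℂ), IsJordanReduction A α lam P Q := by
  obtain ⟨l, s, μ, P, Q, H, hcard⟩ := hA
  have hex : ∀ j, ∃ i, ∀ i', μ i' = lam j ↔ i' = i := by
    intro j
    obtain ⟨i, hi⟩ := Finset.card_eq_one.1 (hcard (lam j) (hspec ▸ ⟨j, rfl⟩))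
    refine ⟨i, fun i' => ?_⟩
    have := Finset.ext_iff.1 hi i'
    simpa using this
  choose σ hσ using hex
  have hbij : Function.Bijective σ := by
    constructor
    · intro j j' h
      apply hlam
      rw [← (hσ j _).2 rfl, h, (hσ j' _).2 rfl]
    · intro i
      obtain ⟨j, hj⟩ : μ i ∈ Set.range lam := hspec ▸ H.mem_spectrum i
      exact ⟨j, ((hσ j i).1 hj.symm).symm⟩
  have hμ : μ ∘ Equiv.ofBijective σ hbij = lam := by
    ext j
    exact (hσ j _).2 rfl
  have := H.reindex (Equiv.ofBijective σ hbij)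
  rw [hμ] at this
  exact ⟨_, _, _, this⟩

end Eigenvalues

end

theorem theorem5 {n k : ℕ} (A : Matrix (Fin n) (Fin n) ℂ) (hA : NonDerogatory A)
    (p : ℕ) (hp : 2 ≤ p) (g : ℂ[X]) (hg : g.eval 0 ≠ 0)
    (lam : Fin k → ℂ) (hlam : Function.Injective lam) (hspec : Set.range lam = spectrum ℂ A) :
    (∃ (α : Fin k → ℕ) (P : Matrix (Fin n) (Σ i, Fin (α i)) ℂ)
        (Q : Matrix (Σ i, Fin (α i)) (Fin n) ℂ),
      IsJordanReduction A α lam P Q ∧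
        entrySet P ⊆ IntermediateField.adjoin ℚ (entrySet A ∪ Set.range lam)) ∧
    ∀ (α : Fin k → ℕ) (P : Matrix (Fin n) (Σ i, Fin (α i)) ℂ)
        (Q : Matrix (Σ i, Fin (α i)) (Fin n) ℂ),
      IsJordanReduction A α lam P Q →
        Set.BijOn (fun u : ∀ i, Fin (α i - 1) → ℂ => solutionOf P Q (X ^ p * g) u)
          {u | ∀ i, AdmissibleColumn (X ^ p * g) (u i)}
          {M | IsNilpotent M ∧ M * A - A * M = M ^ p * Polynomial.aeval M g} ∧
        Module.finrank ℂ (∀ i, Fin (α i - 1) → ℂ) + k = n ∧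
        (entrySet P ⊆ IntermediateField.adjoin ℚ (entrySet A ∪ Set.range lam) →
          ∀ u : ∀ i, Fin (α i - 1) → ℂ, (∀ i, AdmissibleColumn (X ^ p * g) (u i)) →
            entrySet (solutionOf P Q (X ^ p * g) u) ⊆
              IntermediateField.adjoin ℚ (entrySet A ∪ Set.range lam ∪
                Set.range g.coeff ∪ {z | ∃ i a, u i a = z})) := by
  have h0 : (X ^ p * g).coeff 0 = 0 := by
    rw [coeff_X_pow_mul', if_neg (by omega)]
  have h1 : (X ^ p * g).coeff 1 = 0 := by
    rw [coeff_X_pow_mul', if_neg (by omega)]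
  refine ⟨?_, fun α P Q H => ⟨?_, H.finrank_parameters, fun hP u _ => ?_⟩⟩
  · obtain ⟨α, P, Q, H⟩ := hA.exists_isJordanReduction hlam hspec
    obtain ⟨P', Q', H', hP'⟩ := H.exists_entries_mem hlam
      (F := IntermediateField.adjoin ℚ (entrySet A ∪ Set.range lam))
      (fun i j => IntermediateField.subset_adjoin _ _ (Or.inl ⟨i, j, rfl⟩))
      (fun i => IntermediateField.subset_adjoin _ _ (Or.inr ⟨i, rfl⟩))
    exact ⟨α, P', Q', H', entrySet_subset_iff.2 hP'⟩
  · simpa using H.bijOn_solutionOf hlam h0 h1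
  · rw [entrySet_subset_iff] at hP ⊢
    refine H.solutionOf_apply_mem (fun i j => ?_) (fun l => ?_) fun i a => ?_
    · refine IntermediateField.adjoin.mono ℚ _ _ ?_ (hP i j)
      exact Set.subset_union_left.trans Set.subset_union_left
    · rw [coeff_X_pow_mul']
      split_ifs
      · exact IntermediateField.subset_adjoin _ _ (Or.inl (Or.inr ⟨_, rfl⟩))
      · exact zero_mem _
    · exact IntermediateField.subset_adjoin _ _ (Or.inr ⟨i, a, rfl⟩)
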